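/- Let $\mathbb N=\{1,2,\dots\}$. For families $\mathcal F,\mathcal G$ of finite subsets of $\mathbb N$ let $\mathcal F[\mathcal G]=\{\bigcup_{i=1}^kG_i: G_i\in\mathcal G,\ \emptyset\neq G_i,\ G_1<\dots<G_k,\ \{\min G_i\}_{i=1}^k\in\mathcal F\}$, where $G<G'$ means $\max G<\min G'$. The Schreier families are $\mathcal S_0=\{A:|A|\le 1\}$, $\mathcal S_1=\{A:|A|\le\min A\}\cup\{\emptyset\}$ and $\mathcal S_{n+1}=\mathcal S_1[\mathcal S_n]$. For a null sequence $(\theta_n)_{n\ge1}$ in $(0,1)$, the mixed Tsirelson space $T[(\mathcal S_n,\theta_n)_{n=1}^\infty]$ is the completion of the space $c_{00}$ of finitely supported real sequences under the norm determined by $$\|x\|=\max\Big\{\|x\|_{c_0},\ \sup_{n\ge1}\theta_n\sup\sum_{i=1}^k\|E_ix\|\Big\},$$ where the last supremum is over all families $E_1<\dots<E_k$ of nonempty finite subsets of $\mathbb N$ with $\{\min E_i\}_{i=1}^k\in\mathcal S_n$, and $Ex$ is the restriction of $x$ to $E$. Its unit vectors $(e_k)$ form a normalized basis. The sequence $(\theta_n)$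 is called regular if it is a non-increasing null sequence in $(0,1)$ with $\theta_{m+n}\ge\theta_m\theta_n$ for all $m,n$. Write $(y_k)\prec(x_k)$ if $(y_k)$ is a normalized block basis of $(x_k)$. Two sequences $(x_k)$ and $(y_k)$ in normed spaces are equivalent if there is a finite constant $K$ with $K^{-1}\|\sum a_kx_k\|\le\|\sum a_ky_k\|\le K\|\sum a_kx_k\|$ for all $(a_k)\in c_{00}$. A Banach space $X$ with a normalized basis $(e_k)$ is strongly non-subsequentially minimal if for every $(x_k)\prec(e_k)$ there is $(y_k)\prec(x_k)$ such that no $(z_k)\prec(y_k)$ is equivalent to a subsequence of $(e_k)$. **Theorem.** For every real number $0<\theta<1$ there is a regular sequence $(\theta_n)_{n\ge1}$ with $\sup_n\theta_n^{1/n}=\theta$ such that, with $\varphi_n=\theta_n/\theta^n$, one has $\lim_n\varphi_n=1$ and the space $T[(\mathcal S_n,\theta_n)_{n=1}^\infty]$ with its unit vector basis is strongly non-subsequentially minimal. In particular $\inf_n\varphi_n>0$ and $\sup_n\varphi_n=1$, so in the theorem "if $0<\inf_n\varphi_n\le\sup_n\varphi_n<1$, then $T[(\mathcal S_n,\theta_n)_{n=1}^\infty]$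 is strongly non-subsequentially minimal" the condition $\sup_n\varphi_n<1$ is not necessary for the conclusion. -/

import Mathlib

open Set Filter Topology

noncomputable section

namespace MixedTsirelson

/-! ### Schreier families (the natural numbers start at `1` and are modelled by `ℕ+`) -/

/-- `E` is a finite sequence of nonempty finite sets with `E 0 < E 1 < ⋯`. -/
def Successive {k : ℕ} (E : Fin k → Finset ℕ+) : Prop :=
  (∀ i, (E i).Nonempty) ∧ ∀ i j, i < j → ∀ a ∈ E i, ∀ b ∈ E j, a < b

/-- The set `{min E_i : i}` of minima of a finite sequence of sets belongs to the family `𝓕`. -/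
def MinsIn (𝓕 : Set (Finset ℕ+)) {k : ℕ} (E : Fin k → Finset ℕ+) : Prop :=
  ∃ F ∈ 𝓕, ∀ m, m ∈ F ↔ ∃ i, IsLeast (E i : Set ℕ+) m

/-- `𝓕[𝓖] = {⋃ᵢ Gᵢ : Gᵢ ∈ 𝓖, G₁ < ⋯ < Gₖ, (min Gᵢ)ᵢ ∈ 𝓕}`. -/
def convolution (𝓕 𝓖 : Set (Finset ℕ+)) : Set (Finset ℕ+) :=
  {A | ∃ (k : ℕ) (G : Fin k → Finset ℕ+), (∀ i, G i ∈ 𝓖) ∧ Successive G ∧ MinsIn 𝓕 G ∧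
    A = Finset.univ.biUnion G}

/-- The first Schreier family: `|A| ≤ min A`, together with the empty set. -/
def schreierOne : Set (Finset ℕ+) := {A | ∀ a ∈ A, A.card ≤ (a : ℕ)}

/-- The Schreier families of finite order. The family of order `1` is `schreierOne`,
see `schreier_one`. -/
def Schreier : ℕ → Set (Finset ℕ+)
  | 0 => {A | A.card ≤ 1}
  | n + 1 => convolution schreierOne (Schreier n)

/-- `S_n`-admissible families: `E_1 < ⋯ < E_k` and `(min E_i) ∈ S_n`. -/
def Admissible (n : ℕ) {k : ℕ} (E : Fin k → Finset ℕ+) : Prop :=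
  Successive E ∧ MinsIn (Schreier n) E

theorem schreier_one : Schreier 1 = schreierOne := by
  ext A
  constructor
  · rintro ⟨k, G, hG, hs, ⟨F, hF, hm⟩, rfl⟩
    have : Finset.univ.biUnion G = F := by
      ext m
      rw [hm]
      simp only [Finset.mem_biUnion, Finset.mem_univ, true_and]
      refine exists_congr fun i => ⟨fun h => ⟨h, fun b hb => ?_⟩, fun h => h.1⟩
      exact (Finset.card_le_one.1 (hG i) m h b hb).le
    rw [this]
    exact hF
  · intro hA
    refine ⟨A.card, fun i => {A.orderEmbOfFin rfl i}, fun i => by simp [Schreier],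
      ⟨fun i => by simp, ?_⟩, ⟨A, hA, ?_⟩, ?_⟩
    · intro i j hij a ha b hb
      simp only [Finset.mem_singleton] at ha hb
      subst ha hb
      simpa using hij
    · intro m
      have : m ∈ A ↔ m ∈ Set.range (A.orderEmbOfFin rfl) := by simp
      rw [this]
      simp only [Set.mem_range, Finset.coe_singleton]
      refine exists_congr fun i => ⟨fun h => h ▸ isLeast_singleton, fun h => h.1.symm⟩
    · ext m
      have : m ∈ A ↔ m ∈ Set.range (A.orderEmbOfFin rfl) := by simp
      rw [this]
      simp only [Finset.mem_biUnion, Finset.mem_univ, true_and, Finset.mem_singleton, Set.mem_range]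
      exact exists_congr fun i => eq_comm

/-! ### The norm -/

/-- A null sequence `(θ_n)_{n ≥ 1}` in `(0,1)`. -/
structure Weights where
  toFun : ℕ+ → ℝ
  pos' : ∀ n, 0 < toFun n
  lt_one' : ∀ n, toFun n < 1
  tendsto' : Tendsto toFun atTop (𝓝 0)

instance : CoeFun Weights (fun _ => ℕ+ → ℝ) := ⟨Weights.toFun⟩

/-- Regular sequences: non-increasing with `θ_{m+n} ≥ θ_m θ_n`
(and null in `(0,1)`, as part of the type). -/
def Weights.IsRegular (θ : Weights) : Prop :=
  Antitone θ ∧ ∀ m n : ℕ+, θ m * θ n ≤ θ (m + n)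

/-- The coordinate restriction `E x` of a finitely supported sequence `x`. -/
def restrict (E : Finset ℕ+) (x : ℕ+ →₀ ℝ) : ℕ+ →₀ ℝ := x.filter (· ∈ E)

/-- The numbers `|x_i|` and `θ_n ∑ᵢ N (Eᵢ x)`, where `n ≥ 1` and `(Eᵢ)` is `S_n`-admissible. -/
def normSet (θ : Weights) (N : (ℕ+ →₀ ℝ) → ℝ) (x : ℕ+ →₀ ℝ) : Set ℝ :=
  Set.range (fun i => |x i|) ∪
    {r | ∃ (n : ℕ+) (k : ℕ) (E : Fin k → Finset ℕ+), Admissible n E ∧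
      r = θ n * ∑ i, N (restrict (E i) x)}

/-- The implicit equation
`N x = max {‖x‖_{c₀}, sup_n θ_n sup ∑ᵢ N (Eᵢ x)}`, the last supremum being over all
`S_n`-admissible families. -/
def IsImplicitNorm (θ : Weights) (N : (ℕ+ →₀ ℝ) → ℝ) : Prop :=
  ∀ x, IsLUB (normSet θ N x) (N x)

/-- The iterates that approximate the norm from below, starting with the `c₀`-norm. -/
def iterNorm (θ : Weights) : ℕ → (ℕ+ →₀ ℝ) → ℝ
  | 0, x => sSup (Set.range fun i => |x i|)
  | m + 1, x => sSup (normSet θ (iterNorm θ m) x)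

/-- The mixed Tsirelson norm on `c₀₀`. It is the unique solution of the implicit equation, see
`isImplicitNorm_tsNorm` and `IsImplicitNorm.eq_tsNorm`. -/
def tsNorm (θ : Weights) (x : ℕ+ →₀ ℝ) : ℝ := ⨆ m, iterNorm θ m x

section Facts

variable (θ : Weights)

theorem restrict_apply (E : Finset ℕ+) (x : ℕ+ →₀ ℝ) (i : ℕ+) :
    restrict E x i = if i ∈ E then x i else 0 := by
  simp [restrict, Finsupp.filter_apply]

def l1 (x : ℕ+ →₀ ℝ) : ℝ := ∑ i ∈ x.support, |x i|

theorem l1_nonneg (x : ℕ+ →₀ ℝ) : 0 ≤ l1 x := Finset.sum_nonneg fun _ _ => abs_nonneg _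

theorem l1_restrict (E : Finset ℕ+) (x : ℕ+ →₀ ℝ) :
    l1 (restrict E x) = ∑ i ∈ x.support, if i ∈ E then |x i| else 0 := by
  unfold l1
  rw [Finset.sum_subset (s₂ := x.support)]
  · refine Finset.sum_congr rfl fun i _ => ?_
    rw [restrict_apply]
    split_ifs <;> simp
  · intro i hi
    simp only [Finsupp.mem_support_iff, restrict_apply] at hi ⊢
    intro h
    simp [h] at hi
  · intro i _ hi
    simpa using hi

theorem sum_l1_restrict_le {k : ℕ} {E : Fin k → Finset ℕ+} (hE : Successive E) (x : ℕ+ →₀ ℝ) :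
    ∑ i, l1 (restrict (E i) x) ≤ l1 x := by
  simp only [l1_restrict]
  rw [Finset.sum_comm]
  refine Finset.sum_le_sum fun j _ => ?_
  by_cases h : ∃ i, j ∈ E i
  · obtain ⟨i, hi⟩ := h
    rw [Finset.sum_eq_single i]
    · simp [hi]
    · intro i' _ hne
      rw [if_neg]
      intro hj
      rcases lt_or_gt_of_ne hne with h | h
      · exact lt_irrefl _ (hE.2 _ _ h _ hj _ hi)
      · exact lt_irrefl _ (hE.2 _ _ h _ hi _ hj)
    · simp
  · rw [Finset.sum_eq_zero]
    · exact abs_nonneg _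
    · intro i _
      exact if_neg fun hi => h ⟨i, hi⟩

theorem abs_le_l1 (x : ℕ+ →₀ ℝ) (i : ℕ+) : |x i| ≤ l1 x := by
  by_cases h : i ∈ x.support
  · exact Finset.single_le_sum (f := fun i => |x i|) (fun _ _ => abs_nonneg _) h
  · rw [Finsupp.notMem_support_iff.1 h, abs_zero]
    exact l1_nonneg x

theorem normSet_le_l1 {N : (ℕ+ →₀ ℝ) → ℝ} (hN : ∀ x, N x ≤ l1 x) (x : ℕ+ →₀ ℝ) :
    ∀ r ∈ normSet θ N x, r ≤ l1 x := by
  rintro r (⟨i, rfl⟩ | ⟨n, k, E, hE, rfl⟩)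
  · exact abs_le_l1 x i
  · have h1 : ∑ i, N (restrict (E i) x) ≤ l1 x :=
      (Finset.sum_le_sum fun i _ => hN _).trans (sum_l1_restrict_le hE.1 x)
    calc θ n * ∑ i, N (restrict (E i) x) ≤ θ n * l1 x :=
          mul_le_mul_of_nonneg_left h1 (θ.pos' n).le
      _ ≤ 1 * l1 x := mul_le_mul_of_nonneg_right (θ.lt_one' n).le (l1_nonneg x)
      _ = l1 x := one_mul _

theorem normSet_nonempty (N : (ℕ+ →₀ ℝ) → ℝ) (x : ℕ+ →₀ ℝ) : (normSet θ N x).Nonempty :=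
  ⟨_, Or.inl ⟨1, rfl⟩⟩

theorem iterNorm_le_l1 (m : ℕ) (x : ℕ+ →₀ ℝ) : iterNorm θ m x ≤ l1 x := by
  induction m generalizing x with
  | zero =>
    refine csSup_le (Set.range_nonempty _) ?_
    rintro _ ⟨i, rfl⟩
    exact abs_le_l1 x i
  | succ m ih => exact csSup_le (normSet_nonempty θ _ x) (normSet_le_l1 θ ih x)

theorem iterNorm_succ_isLUB (m : ℕ) (x : ℕ+ →₀ ℝ) :
    IsLUB (normSet θ (iterNorm θ m) x) (iterNorm θ (m + 1) x) :=
  isLUB_csSup (normSet_nonempty θ _ x) ⟨_, normSet_le_l1 θ (iterNorm_le_l1 θ m) x⟩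

theorem iterNorm_zero_isLUB (x : ℕ+ →₀ ℝ) :
    IsLUB (Set.range fun i => |x i|) (iterNorm θ 0 x) := by
  refine isLUB_csSup (Set.range_nonempty _) ⟨l1 x, ?_⟩
  rintro _ ⟨i, rfl⟩
  exact abs_le_l1 x i

theorem abs_le_iterNorm (m : ℕ) (x : ℕ+ →₀ ℝ) (i : ℕ+) : |x i| ≤ iterNorm θ m x := by
  cases m with
  | zero => exact (iterNorm_zero_isLUB θ x).1 ⟨i, rfl⟩
  | succ m => exact (iterNorm_succ_isLUB θ m x).1 (Or.inl ⟨i, rfl⟩)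

theorem iterNorm_le_succ (m : ℕ) (x : ℕ+ →₀ ℝ) : iterNorm θ m x ≤ iterNorm θ (m + 1) x := by
  induction m generalizing x with
  | zero =>
    refine (iterNorm_zero_isLUB θ x).2 ?_
    rintro _ ⟨i, rfl⟩
    exact abs_le_iterNorm θ 1 x i
  | succ m ih =>
    refine (iterNorm_succ_isLUB θ m x).2 ?_
    rintro r (⟨i, rfl⟩ | ⟨n, k, E, hE, rfl⟩)
    · exact abs_le_iterNorm θ _ x i
    · exact (mul_le_mul_of_nonneg_left (Finset.sum_le_sum fun i _ => ih _) (θ.pos' n).le).trans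
        ((iterNorm_succ_isLUB θ (m + 1) x).1 (Or.inr ⟨n, k, E, hE, rfl⟩))

theorem iterNorm_monotone (x : ℕ+ →₀ ℝ) : Monotone fun m => iterNorm θ m x :=
  monotone_nat_of_le_succ fun m => iterNorm_le_succ θ m x

theorem iterNorm_bddAbove (x : ℕ+ →₀ ℝ) : BddAbove (Set.range fun m => iterNorm θ m x) := by
  refine ⟨l1 x, ?_⟩
  rintro _ ⟨m, rfl⟩
  exact iterNorm_le_l1 θ m x

theorem iterNorm_le_tsNorm (m : ℕ) (x : ℕ+ →₀ ℝ) : iterNorm θ m x ≤ tsNorm θ x :=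
  le_ciSup (iterNorm_bddAbove θ x) m

theorem tendsto_iterNorm (x : ℕ+ →₀ ℝ) :
    Tendsto (fun m => iterNorm θ m x) atTop (𝓝 (tsNorm θ x)) :=
  tendsto_atTop_ciSup (iterNorm_monotone θ x) (iterNorm_bddAbove θ x)

/-- The norm satisfies the implicit equation. -/
theorem isImplicitNorm_tsNorm : IsImplicitNorm θ (tsNorm θ) := by
  intro x
  constructor
  · rintro r (⟨i, rfl⟩ | ⟨n, k, E, hE, rfl⟩)
    · exact (abs_le_iterNorm θ 0 x i).trans (iterNorm_le_tsNorm θ 0 x)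
    · have h : Tendsto (fun m => θ n * ∑ i, iterNorm θ m (restrict (E i) x)) atTop
          (𝓝 (θ n * ∑ i, tsNorm θ (restrict (E i) x))) :=
        (tendsto_finsetSum _ fun i _ => tendsto_iterNorm θ _).const_mul _
      refine le_of_tendsto' h fun m => ?_
      exact ((iterNorm_succ_isLUB θ m x).1 (Or.inr ⟨n, k, E, hE, rfl⟩)).trans
        (iterNorm_le_tsNorm θ _ x)
  · intro b hb
    refine ciSup_le fun m => ?_
    cases m with
    | zero =>
      refine (iterNorm_zero_isLUB θ x).2 ?_
      rintro _ ⟨i, rfl⟩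
      exact hb (Or.inl ⟨i, rfl⟩)
    | succ m =>
      refine (iterNorm_succ_isLUB θ m x).2 ?_
      rintro r (⟨i, rfl⟩ | ⟨n, k, E, hE, rfl⟩)
      · exact hb (Or.inl ⟨i, rfl⟩)
      · exact (mul_le_mul_of_nonneg_left
          (Finset.sum_le_sum fun i _ => iterNorm_le_tsNorm θ m _) (θ.pos' n).le).trans
          (hb (Or.inr ⟨n, k, E, hE, rfl⟩))

theorem abs_le_tsNorm (x : ℕ+ →₀ ℝ) (i : ℕ+) : |x i| ≤ tsNorm θ x :=
  (isImplicitNorm_tsNorm θ x).1 (Or.inl ⟨i, rfl⟩)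

theorem tsNorm_nonneg (x : ℕ+ →₀ ℝ) : 0 ≤ tsNorm θ x :=
  (abs_nonneg _).trans (abs_le_tsNorm θ x 1)

theorem tsNorm_le_l1 (x : ℕ+ →₀ ℝ) : tsNorm θ x ≤ l1 x :=
  ciSup_le fun m => iterNorm_le_l1 θ m x

theorem tsNorm_zero : tsNorm θ 0 = 0 :=
  le_antisymm ((tsNorm_le_l1 θ 0).trans (by simp [l1])) (tsNorm_nonneg θ 0)

theorem restrict_add (E : Finset ℕ+) (x y : ℕ+ →₀ ℝ) :
    restrict E (x + y) = restrict E x + restrict E y := Finsupp.filter_add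

theorem iterNorm_add_le (m : ℕ) (x y : ℕ+ →₀ ℝ) :
    iterNorm θ m (x + y) ≤ iterNorm θ m x + iterNorm θ m y := by
  induction m generalizing x y with
  | zero =>
    refine (iterNorm_zero_isLUB θ _).2 ?_
    rintro _ ⟨i, rfl⟩
    exact (abs_add_le _ _).trans (add_le_add (abs_le_iterNorm θ 0 x i) (abs_le_iterNorm θ 0 y i))
  | succ m ih =>
    refine (iterNorm_succ_isLUB θ m _).2 ?_
    rintro r (⟨i, rfl⟩ | ⟨n, k, E, hE, rfl⟩)
    · exact (abs_add_le _ _).trans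
        (add_le_add (abs_le_iterNorm θ _ x i) (abs_le_iterNorm θ _ y i))
    · have h1 : ∑ i, iterNorm θ m (restrict (E i) (x + y)) ≤
          ∑ i, iterNorm θ m (restrict (E i) x) + ∑ i, iterNorm θ m (restrict (E i) y) := by
        rw [← Finset.sum_add_distrib]
        refine Finset.sum_le_sum fun i _ => ?_
        rw [restrict_add]
        exact ih _ _
      have h2 := mul_le_mul_of_nonneg_left h1 (θ.pos' n).le
      rw [mul_add] at h2
      exact h2.trans (add_le_add
        ((iterNorm_succ_isLUB θ m x).1 (Or.inr ⟨n, k, E, hE, rfl⟩))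
        ((iterNorm_succ_isLUB θ m y).1 (Or.inr ⟨n, k, E, hE, rfl⟩)))

theorem tsNorm_add_le (x y : ℕ+ →₀ ℝ) : tsNorm θ (x + y) ≤ tsNorm θ x + tsNorm θ y :=
  ciSup_le fun m => (iterNorm_add_le θ m x y).trans
    (add_le_add (iterNorm_le_tsNorm θ m x) (iterNorm_le_tsNorm θ m y))

/-- The norm is a lattice norm, so the unit vectors will form a `1`-unconditional basis. -/
theorem iterNorm_mono_abs (m : ℕ) {x y : ℕ+ →₀ ℝ} {c : ℝ} (hc : 0 ≤ c)
    (h : ∀ i, |x i| ≤ c * |y i|) : iterNorm θ m x ≤ c * iterNorm θ m y := by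
  induction m generalizing x y with
  | zero =>
    refine (iterNorm_zero_isLUB θ _).2 ?_
    rintro _ ⟨i, rfl⟩
    exact (h i).trans (mul_le_mul_of_nonneg_left (abs_le_iterNorm θ 0 y i) hc)
  | succ m ih =>
    refine (iterNorm_succ_isLUB θ m _).2 ?_
    rintro r (⟨i, rfl⟩ | ⟨n, k, E, hE, rfl⟩)
    · exact (h i).trans (mul_le_mul_of_nonneg_left (abs_le_iterNorm θ _ y i) hc)
    · have h1 : ∑ i, iterNorm θ m (restrict (E i) x) ≤
          c * ∑ i, iterNorm θ m (restrict (E i) y) := by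
        rw [Finset.mul_sum]
        refine Finset.sum_le_sum fun i _ => ih fun j => ?_
        rw [restrict_apply, restrict_apply]
        split_ifs
        · exact h j
        · simp
      have h2 := mul_le_mul_of_nonneg_left h1 (θ.pos' n).le
      rw [mul_left_comm] at h2
      exact h2.trans (mul_le_mul_of_nonneg_left
        ((iterNorm_succ_isLUB θ m y).1 (Or.inr ⟨n, k, E, hE, rfl⟩)) hc)

theorem tsNorm_mono_abs {x y : ℕ+ →₀ ℝ} {c : ℝ} (hc : 0 ≤ c)
    (h : ∀ i, |x i| ≤ c * |y i|) : tsNorm θ x ≤ c * tsNorm θ y :=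
  ciSup_le fun m => (iterNorm_mono_abs θ m hc h).trans
    (mul_le_mul_of_nonneg_left (iterNorm_le_tsNorm θ m y) hc)

theorem tsNorm_smul (c : ℝ) (x : ℕ+ →₀ ℝ) : tsNorm θ (c • x) = |c| * tsNorm θ x := by
  have key : ∀ (c : ℝ) (x : ℕ+ →₀ ℝ), tsNorm θ (c • x) ≤ |c| * tsNorm θ x := fun c x =>
    tsNorm_mono_abs θ (abs_nonneg c) fun i => by simp [abs_mul]
  refine le_antisymm (key c x) ?_
  rcases eq_or_ne c 0 with rfl | hc
  · simp [tsNorm_zero]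
  · have h := key c⁻¹ (c • x)
    rw [inv_smul_smul₀ hc, abs_inv] at h
    have hc' : 0 < |c| := abs_pos.2 hc
    calc |c| * tsNorm θ x ≤ |c| * (|c|⁻¹ * tsNorm θ (c • x)) :=
          mul_le_mul_of_nonneg_left h hc'.le
      _ = tsNorm θ (c • x) := by rw [← mul_assoc, mul_inv_cancel₀ hc'.ne', one_mul]

theorem tsNorm_eq_zero {x : ℕ+ →₀ ℝ} (h : tsNorm θ x = 0) : x = 0 := by
  ext i
  have := abs_le_tsNorm θ x i
  rw [h] at this
  simpa using this

theorem exists_bound : ∃ q : ℝ, 0 ≤ q ∧ q < 1 ∧ ∀ n, θ n ≤ q := by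
  obtain ⟨M, hM⟩ := eventually_atTop.1
    (θ.tendsto'.eventually (gt_mem_nhds (show (0 : ℝ) < 1 / 2 by norm_num)))
  have hne : (Finset.Iic M).Nonempty := ⟨M, by simp⟩
  obtain ⟨m, hm, hmax⟩ := Finset.exists_max_image (Finset.Iic M) θ hne
  refine ⟨max (1 / 2) (θ m), le_max_of_le_left (by norm_num),
    max_lt (by norm_num) (θ.lt_one' m), fun n => ?_⟩
  rcases le_total n M with h | h
  · exact le_max_of_le_right (hmax n (by simpa using h))
  · exact le_max_of_le_left (hM n h).le

theorem restrict_eq_self {E : Finset ℕ+} {x : ℕ+ →₀ ℝ} (h : x.support ⊆ E) :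
    restrict E x = x := by
  ext i
  rw [restrict_apply]
  split_ifs with hi
  · rfl
  · by_contra hne
    exact hi (h (Finsupp.mem_support_iff.2 (Ne.symm hne)))

theorem card_support_restrict_lt {E : Finset ℕ+} {x : ℕ+ →₀ ℝ} (h : ¬ x.support ⊆ E) :
    (restrict E x).support.card < x.support.card := by
  refine Finset.card_lt_card ?_
  rw [restrict, Finsupp.support_filter, Finset.filter_ssubset]
  simpa [Finset.not_subset] using h

theorem IsImplicitNorm.le {N N' : (ℕ+ →₀ ℝ) → ℝ} (hN : IsImplicitNorm θ N)
    (hN' : IsImplicitNorm θ N') (h0 : N 0 = 0) (h0' : N' 0 = 0) (x : ℕ+ →₀ ℝ) : N x ≤ N' x := by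
  obtain ⟨q, hq0, hq1, hq⟩ := exists_bound θ
  induction hc : x.support.card using Nat.strong_induction_on generalizing x with
  | _ c ih =>
    subst hc
    have hpos : ∀ {N : (ℕ+ →₀ ℝ) → ℝ}, IsImplicitNorm θ N → 0 ≤ N x := fun h =>
      (abs_nonneg (x 1)).trans ((h x).1 (Or.inl ⟨1, rfl⟩))
    rcases eq_or_ne x 0 with rfl | hx
    · rw [h0, h0']
    have key : N x ≤ max (N' x) (q * N x) := by
      refine (hN x).2 ?_
      rintro r (⟨i, rfl⟩ | ⟨n, k, E, hE, rfl⟩)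
      · exact le_max_of_le_left ((hN' x).1 (Or.inl ⟨i, rfl⟩))
      · by_cases hsub : ∃ i, x.support ⊆ E i
        · obtain ⟨i, hi⟩ := hsub
          obtain ⟨a, ha⟩ := Finsupp.support_nonempty_iff.2 hx
          refine le_max_of_le_right ?_
          rw [Finset.sum_eq_single i]
          · rw [restrict_eq_self hi]
            exact mul_le_mul_of_nonneg_right (hq n) (hpos hN)
          · intro j _ hj
            have : restrict (E j) x = 0 := by
              ext b
              rw [restrict_apply]
              split_ifs with hb
              · by_contra hne
                have hbi := hi (Finsupp.mem_support_iff.2 hne)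
                rcases lt_or_gt_of_ne hj with h | h
                · exact lt_irrefl _ (hE.1.2 _ _ h _ hb _ hbi)
                · exact lt_irrefl _ (hE.1.2 _ _ h _ hbi _ hb)
              · rfl
            rw [this, h0]
          · simp
        · push Not at hsub
          refine le_max_of_le_left (le_trans ?_ ((hN' x).1 (Or.inr ⟨n, k, E, hE, rfl⟩)))
          refine mul_le_mul_of_nonneg_left (Finset.sum_le_sum fun i _ => ?_) (θ.pos' n).le
          exact ih _ (card_support_restrict_lt (hsub i)) _ rfl
    rcases le_max_iff.1 key with h | h
    · exact h
    · have := hpos hN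
      have h' := hpos hN'
      nlinarith

/-- The implicit equation determines the norm. -/
theorem IsImplicitNorm.eq_tsNorm {N : (ℕ+ →₀ ℝ) → ℝ} (hN : IsImplicitNorm θ N) (h0 : N 0 = 0) :
    N = tsNorm θ :=
  funext fun x => le_antisymm
    (hN.le θ (isImplicitNorm_tsNorm θ) h0 (tsNorm_zero θ) x)
    ((isImplicitNorm_tsNorm θ).le θ hN (tsNorm_zero θ) h0 x)

theorem tsNorm_single (i : ℕ+) : tsNorm θ (Finsupp.single i 1) = 1 := by
  refine le_antisymm ((tsNorm_le_l1 θ _).trans ?_) ?_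
  · rw [l1, Finsupp.support_single _ one_ne_zero]
    simp
  · simpa using abs_le_tsNorm θ (Finsupp.single i 1) i

end Facts

/-! ### The space `T[(S_n, θ_n)]` and its unit vector basis -/

/-- `c₀₀` equipped with the mixed Tsirelson norm. -/
def C00 (_θ : Weights) : Type := ℕ+ →₀ ℝ

instance (θ : Weights) : AddCommGroup (C00 θ) := inferInstanceAs (AddCommGroup (ℕ+ →₀ ℝ))

instance (θ : Weights) : Module ℝ (C00 θ) := inferInstanceAs (Module ℝ (ℕ+ →₀ ℝ))

instance (θ : Weights) : Norm (C00 θ) := ⟨fun x => tsNorm θ x⟩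

theorem C00.core (θ : Weights) : NormedSpace.Core ℝ (C00 θ) where
  norm_nonneg := tsNorm_nonneg θ
  norm_smul := tsNorm_smul θ
  norm_triangle := tsNorm_add_le θ
  norm_eq_zero_iff _ := ⟨tsNorm_eq_zero θ, fun h => h ▸ tsNorm_zero θ⟩

instance (θ : Weights) : NormedAddCommGroup (C00 θ) := NormedAddCommGroup.ofCore (C00.core θ)

instance (θ : Weights) : NormedSpace ℝ (C00 θ) := NormedSpace.ofCore (C00.core θ)

/-- The mixed Tsirelson space `T[(S_n, θ_n)_{n ≥ 1}]`, the completion of `c₀₀`. -/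
abbrev Space (θ : Weights) : Type := UniformSpace.Completion (C00 θ)

/-- The unit vectors, indexed by `ℕ`: `unitVec θ k` is the unit vector at coordinate `k + 1`. -/
def unitVec (θ : Weights) (k : ℕ) : Space θ :=
  ((show C00 θ from Finsupp.single k.succPNat 1 : C00 θ) : Space θ)

/-- The coordinate functionals on `c₀₀`. -/
def coord₀ (θ : Weights) (k : ℕ) : StrongDual ℝ (C00 θ) :=
  LinearMap.mkContinuous (Finsupp.lapply k.succPNat : (ℕ+ →₀ ℝ) →ₗ[ℝ] ℝ) 1 fun x => by
    rw [one_mul]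
    exact abs_le_tsNorm θ x _

/-- The coordinate functionals on the mixed Tsirelson space. -/
def coord (θ : Weights) (k : ℕ) : StrongDual ℝ (Space θ) :=
  (coord₀ θ k).extend UniformSpace.Completion.toComplL

theorem coord_coe (θ : Weights) (k : ℕ) (x : ℕ+ →₀ ℝ) :
    coord θ k ((show C00 θ from x : C00 θ) : Space θ) = x k.succPNat :=
  ContinuousLinearMap.extend_eq (coord₀ θ k) UniformSpace.Completion.denseRange_coe
    (UniformSpace.Completion.isUniformInducing_coe _) _

theorem sum_coord_coe (θ : Weights) (n : ℕ) (x : ℕ+ →₀ ℝ) :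
    ∑ i ∈ Finset.range n, coord θ i ((show C00 θ from x : C00 θ) : Space θ) • unitVec θ i =
      ((show C00 θ from x.filter (· ≤ (n : ℕ)) : C00 θ) : Space θ) := by
  have h : x.filter (fun j : ℕ+ => (j : ℕ) ≤ n) =
      ∑ i ∈ Finset.range n, x i.succPNat • Finsupp.single i.succPNat (1 : ℝ) := by
    ext j
    simp only [Finsupp.filter_apply, Finsupp.finsetSum_apply, Finsupp.smul_apply, smul_eq_mul,
      Finsupp.single_apply]
    split_ifs with hj
    · rw [Finset.sum_eq_single j.natPred]
      · simp
      · intro b _ hb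
        rw [if_neg, mul_zero]
        rintro rfl
        exact hb (by simp)
      · intro hn
        exfalso
        apply hn
        have := PNat.natPred_add_one j
        rw [Finset.mem_range]
        omega
    · symm
      refine Finset.sum_eq_zero fun b hb => ?_
      rw [if_neg, mul_zero]
      rintro rfl
      rw [Finset.mem_range] at hb
      exact hj (by simpa using hb)
  have h' : ((show C00 θ from x.filter (fun j : ℕ+ => (j : ℕ) ≤ n) : C00 θ) : Space θ) =
      UniformSpace.Completion.toComplL (𝕜 := ℝ) (E := C00 θ)
        (∑ i ∈ Finset.range n,
          x i.succPNat • (show C00 θ from Finsupp.single i.succPNat (1 : ℝ) : C00 θ)) :=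
    congrArg _ h
  rw [h', map_sum]
  refine Finset.sum_congr rfl fun i _ => ?_
  rw [map_smul, coord_coe]
  rfl

theorem tsNorm_filter_le (θ : Weights) (n : ℕ) (x : ℕ+ →₀ ℝ) :
    tsNorm θ (x.filter fun j : ℕ+ => (j : ℕ) ≤ n) ≤ tsNorm θ x := by
  have := tsNorm_mono_abs θ (x := x.filter fun j : ℕ+ => (j : ℕ) ≤ n) (y := x)
    zero_le_one fun i => by
      rw [one_mul, Finsupp.filter_apply]
      split_ifs
      · exact le_rfl
      · simp
  rwa [one_mul] at this

theorem norm_sum_coord_le (θ : Weights) (n : ℕ) (x : Space θ) :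
    ‖∑ i ∈ Finset.range n, coord θ i x • unitVec θ i‖ ≤ ‖x‖ := by
  induction x using UniformSpace.Completion.induction_on with
  | hp => exact isClosed_le (by fun_prop) (by fun_prop)
  | ih x =>
    rw [sum_coord_coe θ n x, UniformSpace.Completion.norm_coe, UniformSpace.Completion.norm_coe]
    exact tsNorm_filter_le θ n x

theorem tendsto_sum_coord (θ : Weights) (x : Space θ) :
    Tendsto (fun n => ∑ i ∈ Finset.range n, coord θ i x • unitVec θ i) atTop (𝓝 x) := by
  rw [Metric.tendsto_atTop]
  intro ε hε
  obtain ⟨y, hy⟩ := UniformSpace.Completion.denseRange_coe.exists_dist_lt x (half_pos hε)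
  obtain ⟨M, hM⟩ : ∃ M : ℕ, ∀ j ∈ Finsupp.support (show ℕ+ →₀ ℝ from y), (j : ℕ) ≤ M :=
    ⟨_, fun j hj => Finset.le_sup (f := fun j : ℕ+ => (j : ℕ)) hj⟩
  refine ⟨M, fun n hn => ?_⟩
  have hsum : ∑ i ∈ Finset.range n, coord θ i (y : Space θ) • unitVec θ i = y := by
    rw [sum_coord_coe θ n y]
    have : Finsupp.filter (fun j : ℕ+ => (j : ℕ) ≤ n) (show ℕ+ →₀ ℝ from y) = y := by
      rw [Finsupp.filter_eq_self_iff]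
      intro j hj
      exact (hM j (Finsupp.mem_support_iff.2 hj)).trans hn
    exact congrArg _ this
  have hsub : ∑ i ∈ Finset.range n, coord θ i x • unitVec θ i - x =
      ∑ i ∈ Finset.range n, coord θ i (x - y) • unitVec θ i - (x - y) := by
    simp only [map_sub, sub_smul, Finset.sum_sub_distrib, hsum]
    abel
  rw [dist_eq_norm, hsub]
  rw [dist_eq_norm] at hy
  calc _ ≤ ‖∑ i ∈ Finset.range n, coord θ i (x - y) • unitVec θ i‖ + ‖x - y‖ := norm_sub_le _ _
    _ ≤ ‖x - (y : Space θ)‖ + ‖x - y‖ := by gcongr; exact norm_sum_coord_le θ n _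
    _ < ε := by linarith

/-- The unit vectors form a Schauder basis of the mixed Tsirelson space. -/
def unitBasis (θ : Weights) : SchauderBasis ℝ (Space θ) where
  basis := unitVec θ
  coord := coord θ
  ortho i j := by
    rw [unitVec, coord_coe]
    by_cases h : i = j
    · subst h
      simp
    · have h' : i.succPNat ≠ j.succPNat := fun e => h (Nat.succPNat_inj.1 e)
      rw [Finsupp.single_eq_of_ne h']
      exact (@Pi.single_eq_of_ne ℕ (fun _ => ℝ) _ (Classical.decEq ℕ) j i h 1).symm
  expansion x := by
    rw [HasSum, SummationFilter.conditional_filter_eq_map_range, tendsto_map'_iff]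
    exact tendsto_sum_coord θ x

end MixedTsirelson

/-! ### Block bases, equivalence of sequences, strong non-subsequential minimality -/

/-- `(x_n)` dominates `(y_n)`: there is a finite constant `K` with
`‖∑ a_n y_n‖ ≤ K ‖∑ a_n x_n‖` for all `(a_n) ∈ c₀₀`. -/
def Dominates {X Y : Type*} [NormedAddCommGroup X] [NormedSpace ℝ X]
    [NormedAddCommGroup Y] [NormedSpace ℝ Y] (x : ℕ → X) (y : ℕ → Y) : Prop :=
  ∃ K : ℝ, ∀ a : ℕ →₀ ℝ, ‖a.sum fun n c => c • y n‖ ≤ K * ‖a.sum fun n c => c • x n‖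

/-- Two sequences are equivalent if they dominate each other. -/
def SeqEquivalent {X Y : Type*} [NormedAddCommGroup X] [NormedSpace ℝ X]
    [NormedAddCommGroup Y] [NormedSpace ℝ Y] (x : ℕ → X) (y : ℕ → Y) : Prop :=
  Dominates x y ∧ Dominates y x

/-- `(x_k) ≺ (e_k)`: `(x_k)` is a normalized block basis of `(e_k)`. -/
def IsNormalizedBlockBasis {X : Type*} [NormedAddCommGroup X] [NormedSpace ℝ X]
    (x e : ℕ → X) : Prop :=
  ∃ (p : ℕ → ℕ) (a : ℕ → ℝ), StrictMono p ∧
    (∀ k, x k = ∑ i ∈ Finset.Ico (p k) (p (k + 1)), a i • e i) ∧ ∀ k, ‖x k‖ = 1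

/-- A Banach space `X` with a basis `(e_k)` is strongly non-subsequentially minimal if
the basis is normalized and every normalized block basis `(x_k)` of `(e_k)` has a normalized block basis `(y_k)` such that no
normalized block basis `(z_k)` of `(y_k)` is equivalent to a subsequence of `(e_k)`. -/
def StronglyNonSubsequentiallyMinimal {X : Type*} [NormedAddCommGroup X] [NormedSpace ℝ X]
    (e : SchauderBasis ℝ X) : Prop :=
  (∀ k, ‖e k‖ = 1) ∧ ∀ x : ℕ → X, IsNormalizedBlockBasis x e →
    ∃ y : ℕ → X, IsNormalizedBlockBasis y x ∧
      ∀ z : ℕ → X, IsNormalizedBlockBasis z y →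
        ¬ ∃ n : ℕ → ℕ, StrictMono n ∧ SeqEquivalent z (fun k => e (n k))

/-- The unit vector basis is normalized. -/
theorem MixedTsirelson.norm_unitBasis (θ : MixedTsirelson.Weights) (k : ℕ) :
    ‖MixedTsirelson.unitBasis θ k‖ = 1 :=
  (UniformSpace.Completion.norm_coe _).trans (MixedTsirelson.tsNorm_single θ _)

end

noncomputable section

namespace MixedTsirelson

/-! ### Combinatorics of the Schreier families -/

/-! Take `w n = φ n * θ ^ n` with `φ` increasing to 1 and `θ ≤ φ n < 1`. Block vectors `Z` and unit
vectors `U` are told apart by iterated averages with the same coefficients on both sides: a vector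
of height `h + 1` is one member of the sequence plus `θ⁻¹` times the mean of `N` vectors of height
`h` lying further out.

Every block sequence has normalized blocks whose coordinate sums over `S_M`-sets are as small as
desired (`IsBlock.hasFlatBlocks`). Let the `k`-th vector of `Y` be small on `S_k`. The norm of a
normalized block of `Y` then cannot come from coordinate sums, so `tsNorm_le_of_fam_le_of_sum_le`
yields, for each `m` up to the index, an `S_m`-family on which the norms add up to a constant times
`θ⁻¹ ^ m`. Thus all `h + 1` layers of the average of `Z` contribute equally, and its norm is at
least `c * (h + 1)`.

For `U`, each layer has ℓ₁-norm at most 1. A norming family of order `n + 1` either has small `n`,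
and then a factor `φ (n + 1) ≤ φ L < 1` is lost, or it has large `n`, and then it passes through `n
+ 1` layers that together add only a bounded amount. Hence the norm is at most `C + η * h` up to a
constant, for every `η > 0` (`exists_iterated_average`, `exists_growth_bound`). With `η` small and
`h` large, `U` cannot dominate `Z`. For a given `η` only `φ L < 1` with one finite `L` matters, so
`φ n → 1` does no harm. -/

/-- `a` lies in the interval that starts at `f` and ends before the next element of `F`. -/
def Seg (F : Finset ℕ+) (f a : ℕ+) : Prop := f ≤ a ∧ ∀ g ∈ F, f < g → a < g

instance (F : Finset ℕ+) (f : ℕ+) : DecidablePred (Seg F f) :=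
  fun _ => inferInstanceAs (Decidable (_ ∧ _))

theorem Seg.unique {F : Finset ℕ+} {f g a : ℕ+} (hf : f ∈ F) (hg : g ∈ F) (h : Seg F f a)
    (h' : Seg F g a) : f = g := by
  rcases lt_trichotomy f g with hlt | rfl | hlt
  · exact absurd (h.2 g hg hlt) (not_lt.2 h'.1)
  · rfl
  · exact absurd (h'.2 f hf hlt) (not_lt.2 h.1)

theorem exists_seg {F : Finset ℕ+} {a : ℕ+} (h : ∃ f ∈ F, f ≤ a) : ∃ f ∈ F, Seg F f a := by
  obtain ⟨f, hf, hfa⟩ := h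
  have hne : (F.filter (· ≤ a)).Nonempty := ⟨f, by simp [hf, hfa]⟩
  have hm := Finset.max'_mem _ hne
  rw [Finset.mem_filter] at hm
  refine ⟨_, hm.1, hm.2, fun g hg hlt => ?_⟩
  by_contra hga
  exact absurd (Finset.le_max' (F.filter (· ≤ a)) g (by simp [hg, not_lt.1 hga])) (not_le.2 hlt)

/-- Take for `G` the set of minima of the pieces; cutting `A` at these minima recovers exactly the
pieces. -/
theorem schreier_succ_decomp {n : ℕ} {A : Finset ℕ+} (hA : A ∈ Schreier (n + 1)) :
    ∃ G ∈ schreierOne, G ⊆ A ∧ (∀ a ∈ A, ∃ g ∈ G, g ≤ a) ∧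
      ∀ g ∈ G, A.filter (Seg G g) ∈ Schreier n := by
  obtain ⟨k, E, hE, hs, ⟨F, hF, hm⟩, rfl⟩ := hA
  refine ⟨F, hF, ?_, ?_, ?_⟩
  · intro f hf
    obtain ⟨i, hi⟩ := (hm f).1 hf
    simp only [Finset.mem_biUnion, Finset.mem_univ, true_and]
    exact ⟨i, hi.1⟩
  · intro a ha
    simp only [Finset.mem_biUnion, Finset.mem_univ, true_and] at ha
    obtain ⟨i, hi⟩ := ha
    exact ⟨(E i).min' (hs.1 i), (hm _).2 ⟨i, Finset.isLeast_min' _ _⟩, Finset.min'_le _ _ hi⟩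
  · intro g hg
    obtain ⟨i, hi⟩ := (hm g).1 hg
    convert hE i
    ext a
    simp only [Finset.mem_filter, Finset.mem_biUnion, Finset.mem_univ, true_and]
    constructor
    · rintro ⟨⟨j, hj⟩, hseg⟩
      rcases lt_trichotomy j i with h | rfl | h
      · exact absurd (hs.2 j i h a hj g hi.1) (not_lt.2 hseg.1)
      · exact hj
      · have h1 := Finset.isLeast_min' _ (hs.1 j)
        have := hseg.2 _ ((hm _).2 ⟨j, h1⟩) (hs.2 i j h g hi.1 _ h1.1)
        exact absurd (h1.2 hj) (not_le.2 this)
    · intro ha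
      refine ⟨⟨i, ha⟩, hi.2 ha, fun g' hg' hlt => ?_⟩
      obtain ⟨j, hj⟩ := (hm g').1 hg'
      rcases lt_trichotomy j i with h | rfl | h
      · exact absurd (hs.2 j i h g' hj.1 g hi.1) (not_lt.2 hlt.le)
      · exact absurd (hj.2 hi.1) (not_le.2 hlt)
      · exact hs.2 i j h a ha g' hj.1

/-- The sets `K g` may be empty and need not start at `g`. Dropping pieces lowers the number of
minima and moving right raises them, so the condition of `schreierOne` survives. -/
theorem biUnion_mem_schreier_succ {n : ℕ} {G : Finset ℕ+} (hG : G ∈ schreierOne)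
    {K : ℕ+ → Finset ℕ+} (hK : ∀ g ∈ G, K g ∈ Schreier n)
    (hseg : ∀ g ∈ G, ∀ a ∈ K g, Seg G g a) : G.biUnion K ∈ Schreier (n + 1) := by
  set H := G.filter fun g => (K g).Nonempty with hH
  have hHG : ∀ g ∈ H, g ∈ G ∧ (K g).Nonempty := fun g hg => by simpa [hH] using hg
  let e := H.orderEmbOfFin rfl
  have he : ∀ i, e i ∈ H := fun i => Finset.orderEmbOfFin_mem H rfl i
  have hran : ∀ g ∈ H, ∃ i, e i = g := fun g hg => by
    have : g ∈ Set.range (H.orderEmbOfFin rfl) := by simpa using hg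
    exact this
  -- The value `g` for an empty `K g` is a dummy: `μ` is only used on `H`.
  let μ : ℕ+ → ℕ+ := fun g => if h : (K g).Nonempty then (K g).min' h else g
  have hμ : ∀ g ∈ H, IsLeast (K g : Set ℕ+) (μ g) := fun g hg => by
    simp only [μ, dif_pos (hHG g hg).2]
    exact Finset.isLeast_min' _ _
  refine ⟨H.card, fun i => K (e i), fun i => hK _ (hHG _ (he i)).1,
    ⟨fun i => (hHG _ (he i)).2, ?_⟩, ⟨H.image μ, ?_, ?_⟩, ?_⟩
  · intro i j hij a ha b hb
    have h1 := hseg _ (hHG _ (he i)).1 a ha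
    have h2 := hseg _ (hHG _ (he j)).1 b hb
    exact (h1.2 _ (hHG _ (he j)).1 (e.strictMono hij)).trans_le h2.1
  · intro a ha
    obtain ⟨g, hg, rfl⟩ := Finset.mem_image.1 ha
    have h1 : (H.image μ).card ≤ G.card :=
      Finset.card_image_le.trans (Finset.card_le_card (Finset.filter_subset _ _))
    have h2 : g ≤ μ g := (hseg g (hHG g hg).1 _ (hμ g hg).1).1
    exact (h1.trans (hG g (hHG g hg).1)).trans h2
  · intro m
    constructor
    · intro hm
      obtain ⟨g, hg, rfl⟩ := Finset.mem_image.1 hm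
      obtain ⟨i, rfl⟩ := hran g hg
      exact ⟨i, hμ _ hg⟩
    · rintro ⟨i, hi⟩
      exact Finset.mem_image.2 ⟨e i, he i, (hμ _ (he i)).unique hi⟩
  · ext a
    simp only [Finset.mem_biUnion, Finset.mem_univ, true_and]
    constructor
    · rintro ⟨g, hg, ha⟩
      obtain ⟨i, hi⟩ := hran g (by rw [hH, Finset.mem_filter]; exact ⟨hg, a, ha⟩)
      exact ⟨i, hi ▸ ha⟩
    · rintro ⟨i, ha⟩
      exact ⟨e i, (hHG _ (he i)).1, ha⟩

theorem empty_mem_schreier (n : ℕ) : (∅ : Finset ℕ+) ∈ Schreier n := by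
  cases n with
  | zero => simp [Schreier]
  | succ n =>
    have := biUnion_mem_schreier_succ (n := n) (G := ∅) (by simp [schreierOne])
      (K := fun _ => ∅) (by simp) (by simp)
    simpa using this

/-- `S_n[S_k] ⊆ S_{n+k}`, in a form that includes the hereditary and the spreading property. -/
theorem biUnion_mem_schreier {n k : ℕ} {F : Finset ℕ+} (hF : F ∈ Schreier n)
    {K : ℕ+ → Finset ℕ+} (hK : ∀ f ∈ F, K f ∈ Schreier k)
    (hseg : ∀ f ∈ F, ∀ a ∈ K f, Seg F f a) : F.biUnion K ∈ Schreier (n + k) := by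
  induction n generalizing F with
  | zero =>
    rw [zero_add]
    have hF' : F.card ≤ 1 := hF
    rcases Finset.card_le_one_iff_subset_singleton.1 hF' with ⟨f, hf⟩
    rcases Finset.subset_singleton_iff.1 hf with rfl | rfl
    · simpa using empty_mem_schreier k
    · simpa using hK f (by simp)
  | succ n ih =>
    obtain ⟨G, hG, hGF, hcov, hpc⟩ := schreier_succ_decomp hF
    have heq : F.biUnion K = G.biUnion fun g => (F.filter (Seg G g)).biUnion K := by
      ext a
      simp only [Finset.mem_biUnion, Finset.mem_filter]
      constructor
      · rintro ⟨f, hf, ha⟩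
        obtain ⟨g, hg, hs⟩ := exists_seg (hcov f hf)
        exact ⟨g, hg, f, ⟨hf, hs⟩, ha⟩
      · rintro ⟨g, -, f, ⟨hf, -⟩, ha⟩
        exact ⟨f, hf, ha⟩
    rw [heq, show n + 1 + k = n + k + 1 by omega]
    refine biUnion_mem_schreier_succ hG (fun g hg => ?_) ?_
    · refine ih (hpc g hg) (fun f hf => hK f (Finset.mem_filter.1 hf).1) fun f hf a ha => ?_
      have := hseg f (Finset.mem_filter.1 hf).1 a ha
      exact ⟨this.1, fun c hc => this.2 c (Finset.mem_filter.1 hc).1⟩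
    · intro g hg a ha
      simp only [Finset.mem_biUnion, Finset.mem_filter] at ha
      obtain ⟨f, ⟨hf, hs⟩, ha⟩ := ha
      have := hseg f hf a ha
      exact ⟨hs.1.trans this.1, fun c hc hlt => this.2 c (hGF hc) (hs.2 c hc hlt)⟩

theorem singleton_mem_schreier (n : ℕ) (a : ℕ+) : {a} ∈ Schreier n := by
  induction n with
  | zero => simp [Schreier]
  | succ n ih =>
    have := biUnion_mem_schreier_succ (n := n) (G := {a})
      (by intro b _; rw [Finset.card_singleton]; exact b.2) (K := fun _ => {a}) (by simpa using ih)
      (by simp [Seg])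
    simpa using this

/-- Convolve with `S_0`, placing `{f}` at the points to be kept and the empty set at the others. -/
theorem schreier_hereditary {n : ℕ} {F G : Finset ℕ+} (hF : F ∈ Schreier n) (h : G ⊆ F) :
    G ∈ Schreier n := by
  have := biUnion_mem_schreier (k := 0) hF (K := fun f => if f ∈ G then {f} else ∅)
    (fun f _ => by split_ifs <;> simp [Schreier])
    (fun f _ a ha => by
      split_ifs at ha
      · rw [Finset.mem_singleton] at ha
        subst ha
        exact ⟨le_rfl, fun _ _ h => h⟩
      · simp at ha)
  rw [add_zero] at this
  convert this using 1
  ext a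
  simp only [Finset.mem_biUnion]
  constructor
  · intro ha
    exact ⟨a, h ha, by simp [ha]⟩
  · rintro ⟨f, -, ha⟩
    split_ifs at ha with hf
    · rw [Finset.mem_singleton] at ha
      exact ha ▸ hf
    · simp at ha

theorem schreier_mono {m n : ℕ} (h : m ≤ n) : Schreier m ⊆ Schreier n := by
  intro A hA
  obtain ⟨k, rfl⟩ := Nat.exists_eq_add_of_le h
  have := biUnion_mem_schreier (k := k) hA (K := fun a => {a})
    (fun a _ => singleton_mem_schreier k a)
    (fun f _ a ha => by
      rw [Finset.mem_singleton] at ha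
      subst ha
      exact ⟨le_rfl, fun _ _ h => h⟩)
  simpa using this

/-- `S_{m+n} ⊆ S_m[S_n]`. -/
theorem schreier_add_decomp {m n : ℕ} {A : Finset ℕ+} (hA : A ∈ Schreier (m + n)) :
    ∃ G ∈ Schreier m, G ⊆ A ∧ (∀ a ∈ A, ∃ g ∈ G, g ≤ a) ∧
      ∀ g ∈ G, A.filter (Seg G g) ∈ Schreier n := by
  induction m generalizing A with
  | zero =>
    rw [zero_add] at hA
    rcases A.eq_empty_or_nonempty with rfl | hne
    · exact ⟨∅, empty_mem_schreier 0, by simp, by simp, by simp⟩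
    · refine ⟨{A.min' hne}, singleton_mem_schreier 0 _, by simpa using A.min'_mem hne,
        fun a ha => ⟨_, by simp, A.min'_le a ha⟩, fun g _ => ?_⟩
      exact schreier_hereditary hA (Finset.filter_subset _ _)
  | succ m ih =>
    rw [show m + 1 + n = m + n + 1 by omega] at hA
    obtain ⟨H, hH, hHA, hcov, hpc⟩ := schreier_succ_decomp hA
    choose! G hG hGA hGcov hGpc using fun h (hh : h ∈ H) => ih (hpc h hh)
    have hGs : ∀ h ∈ H, ∀ a ∈ G h, a ∈ A ∧ Seg H h a := fun h hh a ha =>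
      Finset.mem_filter.1 (hGA h hh ha)
    refine ⟨H.biUnion G, biUnion_mem_schreier_succ hH hG fun h hh a ha => (hGs h hh a ha).2,
      ?_, ?_, ?_⟩
    · intro a ha
      obtain ⟨h, hh, ha⟩ := Finset.mem_biUnion.1 ha
      exact (hGs h hh a ha).1
    · intro a ha
      obtain ⟨h, hh, hs⟩ := exists_seg (hcov a ha)
      obtain ⟨g, hg, hga⟩ := hGcov h hh a (Finset.mem_filter.2 ⟨ha, hs⟩)
      exact ⟨g, Finset.mem_biUnion.2 ⟨h, hh, hg⟩, hga⟩
    · intro g hg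
      obtain ⟨h, hh, hg⟩ := Finset.mem_biUnion.1 hg
      refine schreier_hereditary (hGpc h hh g hg) fun a ha => ?_
      simp only [Finset.mem_filter] at ha ⊢
      have hgs := hGs h hh g hg
      refine ⟨⟨ha.1, hgs.2.1.trans ha.2.1, fun h' hh' hlt => ?_⟩, ha.2.1, fun g' hg' hlt =>
        ha.2.2 g' (Finset.mem_biUnion.2 ⟨h, hh, hg'⟩) hlt⟩
      -- The point `h'` is the least element of its own slice, and the covering property puts a
      -- point of `G h'` at or below it.
      have hmem : h' ∈ G h' := by
        obtain ⟨c, hc, hle⟩ := hGcov h' hh' h' (Finset.mem_filter.2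
          ⟨hHA hh', le_rfl, fun _ _ h => h⟩)
        have := (hGs h' hh' c hc).2.1
        exact le_antisymm this hle ▸ hc
      exact ha.2.2 h' (Finset.mem_biUnion.2 ⟨h', hh', hmem⟩) (hgs.2.2 h' hh' hlt)

/-! ### The norm in terms of partitions into intervals -/

variable (w : Weights)

theorem tsNorm_le_of_abs_le {x y : ℕ+ →₀ ℝ} (h : ∀ i, |x i| ≤ |y i|) :
    tsNorm w x ≤ tsNorm w y := by
  simpa using tsNorm_mono_abs w zero_le_one (x := x) (y := y) (by simpa using h)

/-- The sum of the norms of the restrictions of `x` to the intervals between consecutive elements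
of `F`. -/
def fam (F : Finset ℕ+) (x : ℕ+ →₀ ℝ) : ℝ := ∑ f ∈ F, tsNorm w (x.filter (Seg F f))

theorem fam_nonneg (F : Finset ℕ+) (x : ℕ+ →₀ ℝ) : 0 ≤ fam w F x :=
  Finset.sum_nonneg fun _ _ => tsNorm_nonneg w _

theorem fam_add_le (F : Finset ℕ+) (x y : ℕ+ →₀ ℝ) : fam w F (x + y) ≤ fam w F x + fam w F y := by
  unfold fam
  rw [← Finset.sum_add_distrib]
  refine Finset.sum_le_sum fun f _ => ?_
  rw [Finsupp.filter_add]
  exact tsNorm_add_le w _ _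

theorem fam_smul (F : Finset ℕ+) (c : ℝ) (x : ℕ+ →₀ ℝ) : fam w F (c • x) = |c| * fam w F x := by
  unfold fam
  rw [Finset.mul_sum]
  refine Finset.sum_congr rfl fun f _ => ?_
  rw [Finsupp.filter_smul, tsNorm_smul]

theorem fam_zero (F : Finset ℕ+) : fam w F 0 = 0 := by
  have := fam_smul w F 0 0
  simpa using this

theorem fam_sum_le {ι : Type*} (F : Finset ℕ+) (s : Finset ι) (x : ι → ℕ+ →₀ ℝ) :
    fam w F (∑ c ∈ s, x c) ≤ ∑ c ∈ s, fam w F (x c) :=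
  Finset.le_sum_of_subadditive _ (fam_zero w F).le (fam_add_le w F) _ _

theorem l1_eq_sum {x : ℕ+ →₀ ℝ} {s : Finset ℕ+} (h : x.support ⊆ s) : l1 x = ∑ i ∈ s, |x i| := by
  unfold l1
  refine Finset.sum_subset h fun i _ hi => ?_
  rw [Finsupp.notMem_support_iff.1 hi, abs_zero]

theorem sum_l1_filter_le {ι : Type*} (s : Finset ι) (p : ι → ℕ+ → Prop)
    [∀ c, DecidablePred (p c)] (hp : ∀ c ∈ s, ∀ c' ∈ s, ∀ i, p c i → p c' i → c = c')
    (x : ℕ+ →₀ ℝ) : ∑ c ∈ s, l1 (x.filter (p c)) ≤ l1 x := by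
  have h1 : ∀ c, l1 (x.filter (p c)) = ∑ i ∈ x.support, if p c i then |x i| else 0 := fun c => by
    rw [l1_eq_sum (s := x.support)]
    · refine Finset.sum_congr rfl fun i _ => ?_
      rw [Finsupp.filter_apply]
      split_ifs <;> simp
    · rw [Finsupp.support_filter]
      exact Finset.filter_subset _ _
  simp only [h1]
  rw [Finset.sum_comm]
  refine Finset.sum_le_sum fun i _ => ?_
  by_cases h : ∃ c ∈ s, p c i
  · obtain ⟨c, hc, hi⟩ := h
    rw [Finset.sum_eq_single_of_mem c hc]
    · rw [if_pos hi]
    · intro c' hc' hne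
      exact if_neg fun hi' => hne (hp _ hc' _ hc _ hi' hi)
  · rw [Finset.sum_eq_zero]
    · exact abs_nonneg _
    · intro c hc
      exact if_neg fun hi => h ⟨c, hc, hi⟩

theorem fam_le_l1 (F : Finset ℕ+) (x : ℕ+ →₀ ℝ) : fam w F x ≤ l1 x :=
  (Finset.sum_le_sum fun _ _ => tsNorm_le_l1 w _).trans
    (sum_l1_filter_le F (fun f => Seg F f) (fun _ hc _ hc' _ h h' => h.unique hc hc' h') x)

/-- The finite set for `f` is the support of `x` in the segment of `f`, with `f` itself adjoined so
that the minimum is exactly `f`. -/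
theorem mul_fam_le_tsNorm (n : ℕ+) {F : Finset ℕ+} (hF : F ∈ Schreier n) (x : ℕ+ →₀ ℝ) :
    w n * fam w F x ≤ tsNorm w x := by
  let e := F.orderEmbOfFin rfl
  have he : ∀ i, e i ∈ F := fun i => Finset.orderEmbOfFin_mem F rfl i
  let E : Fin F.card → Finset ℕ+ := fun i => insert (e i) (x.support.filter (Seg F (e i)))
  have hE : ∀ i, ∀ a ∈ E i, Seg F (e i) a := by
    intro i a ha
    simp only [E, Finset.mem_insert, Finset.mem_filter] at ha
    rcases ha with rfl | ha
    · exact ⟨le_rfl, fun _ _ h => h⟩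
    · exact ha.2
  have hl : ∀ i, IsLeast (E i : Set ℕ+) (e i) := fun i =>
    ⟨by simp [E], fun a ha => (hE i a ha).1⟩
  have hadm : Admissible n E := by
    refine ⟨⟨fun i => ⟨e i, by simp [E]⟩, fun i j hij a ha b hb => ?_⟩, F, hF, fun m => ?_⟩
    · exact ((hE i a ha).2 _ (he j) (e.strictMono hij)).trans_le (hE j b hb).1
    · constructor
      · intro hm
        have : m ∈ Set.range (F.orderEmbOfFin rfl) := by simpa using hm
        obtain ⟨i, hi⟩ := this
        exact ⟨i, hi ▸ hl i⟩
      · rintro ⟨i, hi⟩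
        exact hi.unique (hl i) ▸ he i
  have h := (isImplicitNorm_tsNorm w x).1 (Or.inr ⟨n, _, E, hadm, rfl⟩)
  have hr : ∀ i, restrict (E i) x = x.filter (Seg F (e i)) := by
    intro i
    ext a
    rw [restrict_apply, Finsupp.filter_apply]
    by_cases ha : x a = 0
    · simp [ha]
    · refine if_congr ⟨hE i a, fun hs => ?_⟩ rfl rfl
      simp [E, ha, hs]
  have hs : fam w F x = ∑ i, tsNorm w (restrict (E i) x) := by
    simp only [hr]
    unfold fam
    conv_lhs => rw [show F = Finset.univ.map e.toEmbedding from
      (Finset.map_orderEmbOfFin_univ F rfl).symm]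
    rw [Finset.sum_map]
    simp only [RelEmbedding.coe_toEmbedding]
    rw [show Finset.univ.map e.toEmbedding = F from Finset.map_orderEmbOfFin_univ F rfl]
  rw [hs]
  exact h

/-- Enlarging each set of an admissible family to the whole interval up to the next minimum keeps
the minima and only increases the norms, so interval families suffice. -/
theorem tsNorm_le_of_fam {x : ℕ+ →₀ ℝ} {b : ℝ} (h0 : ∀ i, |x i| ≤ b)
    (h : ∀ n : ℕ+, ∀ F ∈ Schreier n, w n * fam w F x ≤ b) : tsNorm w x ≤ b := by
  refine (isImplicitNorm_tsNorm w x).2 ?_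
  rintro r (⟨i, rfl⟩ | ⟨n, k, E, ⟨hE, F, hF, hm⟩, rfl⟩)
  · exact h0 i
  refine le_trans (mul_le_mul_of_nonneg_left ?_ (w.pos' n).le) (h n F hF)
  let μ : Fin k → ℕ+ := fun i => (E i).min' (hE.1 i)
  have hμ : ∀ i, IsLeast (E i : Set ℕ+) (μ i) := fun i => Finset.isLeast_min' _ _
  have hlt : ∀ i j, i < j → μ i < μ j := fun i j hij => hE.2 i j hij _ (hμ i).1 _ (hμ j).1
  have hinj : Function.Injective μ := (show StrictMono μ from fun i j h => hlt i j h).injective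
  calc ∑ i, tsNorm w (restrict (E i) x) ≤ ∑ i, tsNorm w (x.filter (Seg F (μ i))) := by
        refine Finset.sum_le_sum fun i _ => tsNorm_le_of_abs_le w fun a => ?_
        rw [restrict_apply, Finsupp.filter_apply]
        split_ifs with ha hs
        · exact le_rfl
        · refine absurd ⟨(hμ i).2 ha, fun g hg hlt' => ?_⟩ hs
          obtain ⟨j, hj⟩ := (hm g).1 hg
          have hgj := hj.unique (hμ j)
          rcases lt_trichotomy i j with h | rfl | h
          · exact hE.2 i j h a ha g hj.1
          · exact absurd hlt' (by rw [hgj]; exact lt_irrefl _)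
          · exact absurd hlt' (by rw [hgj]; exact not_lt.2 (hlt _ _ h).le)
        · simp
        · simp
    _ = ∑ f ∈ Finset.univ.image μ, tsNorm w (x.filter (Seg F f)) := by
        rw [Finset.sum_image fun i _ j _ h => hinj h]
    _ ≤ fam w F x := by
        refine Finset.sum_le_sum_of_subset_of_nonneg ?_ fun _ _ _ => tsNorm_nonneg w _
        intro f hf
        obtain ⟨i, -, rfl⟩ := Finset.mem_image.1 hf
        exact (hm _).2 ⟨i, hμ i⟩

/-- The point of the union that follows `a ∈ K f` is either in `K f` or beyond the segment of `f`,
so no interval is cut shorter by passing to the union. -/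
theorem sum_fam_le_fam_biUnion {F : Finset ℕ+} {K : ℕ+ → Finset ℕ+}
    (hseg : ∀ f ∈ F, ∀ a ∈ K f, Seg F f a) (x : ℕ+ →₀ ℝ) :
    ∑ f ∈ F, fam w (K f) (x.filter (Seg F f)) ≤ fam w (F.biUnion K) x := by
  unfold fam
  rw [Finset.sum_biUnion]
  · refine Finset.sum_le_sum fun f hf => Finset.sum_le_sum fun a ha => ?_
    refine tsNorm_le_of_abs_le w fun b => ?_
    simp only [Finsupp.filter_apply]
    split_ifs with h1 h2 h3 <;> try simp
    refine (h3 ⟨h1.1, fun c hc hlt => ?_⟩).elim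
    obtain ⟨f', hf', hc⟩ := Finset.mem_biUnion.1 hc
    rcases lt_trichotomy f f' with h | rfl | h
    · exact (h2.2 f' hf' h).trans_le (hseg f' hf' c hc).1
    · exact h1.2 c hc hlt
    · exact absurd ((hseg f' hf' c hc).2 f hf h)
        (not_lt.2 ((hseg f hf a ha).1.trans hlt.le))
  · intro f hf g hg hne
    rw [Function.onFun, Finset.disjoint_left]
    intro a ha ha'
    exact hne ((hseg f hf a ha).unique hf hg (hseg g hg a ha'))

theorem fam_le_sum_fam {F G : Finset ℕ+} (hGF : G ⊆ F) (hcov : ∀ a ∈ F, ∃ g ∈ G, g ≤ a)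
    (x : ℕ+ →₀ ℝ) :
    fam w F x ≤ ∑ g ∈ G, fam w (F.filter (Seg G g)) (x.filter (Seg G g)) := by
  have heq : F = G.biUnion fun g => F.filter (Seg G g) := by
    ext a
    simp only [Finset.mem_biUnion, Finset.mem_filter]
    constructor
    · intro ha
      obtain ⟨g, hg, hs⟩ := exists_seg (hcov a ha)
      exact ⟨g, hg, ha, hs⟩
    · rintro ⟨g, -, ha, -⟩
      exact ha
  have h1 : fam w F x = ∑ g ∈ G, ∑ f ∈ F.filter (Seg G g), tsNorm w (x.filter (Seg F f)) := by
    unfold fam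
    rw [← Finset.sum_biUnion, ← heq]
    intro f hf g hg hne
    rw [Function.onFun, Finset.disjoint_left]
    intro a ha ha'
    exact hne ((Finset.mem_filter.1 ha).2.unique hf hg (Finset.mem_filter.1 ha').2)
  rw [h1]
  refine Finset.sum_le_sum fun g hg => Finset.sum_le_sum fun f hf => ?_
  refine tsNorm_le_of_abs_le w fun b => ?_
  have hfs := (Finset.mem_filter.1 hf).2
  simp only [Finsupp.filter_apply]
  split_ifs with h1 h2 h3 <;> try simp
  · exact (h3 ⟨hfs.1.trans h1.1, fun c hc hlt => h1.2 c (hGF hc) (hfs.2 c hc hlt)⟩).elim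
  · exact (h2 ⟨h1.1, fun c hc => h1.2 c (Finset.mem_filter.1 hc).1⟩).elim

/-- Each `f` moves right to the first support point of its segment, which loses nothing of `x` and
stays in `S_n` by spreading. This leaves finitely many candidates, so suprema over `S_n` are
attained. -/
theorem exists_subset_support {n : ℕ} {F : Finset ℕ+} (hF : F ∈ Schreier n) (x : ℕ+ →₀ ℝ) :
    ∃ F' ∈ Schreier n, F' ⊆ x.support ∧ fam w F x ≤ fam w F' x := by
  let K : ℕ+ → Finset ℕ+ := fun f =>
    if h : (x.support.filter (Seg F f)).Nonempty then {(x.support.filter (Seg F f)).min' h} else ∅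
  have hK : ∀ f, ∀ a ∈ K f, a ∈ x.support ∧ Seg F f a ∧
      ∀ b ∈ x.support, Seg F f b → a ≤ b := by
    intro f a ha
    simp only [K] at ha
    split_ifs at ha with h
    · rw [Finset.mem_singleton] at ha
      have := Finset.min'_mem _ h
      rw [← ha, Finset.mem_filter] at this
      refine ⟨this.1, this.2, fun b hb hs => ?_⟩
      rw [ha]
      exact Finset.min'_le _ _ (Finset.mem_filter.2 ⟨hb, hs⟩)
    · simp at ha
  refine ⟨F.biUnion K, ?_, ?_, ?_⟩
  · have := biUnion_mem_schreier (k := 0) hF (K := K) (fun f _ => ?_) fun f _ a ha => (hK f a ha).2.1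
    · simpa using this
    · simp only [K]
      split_ifs
      · exact singleton_mem_schreier 0 _
      · exact empty_mem_schreier 0
  · intro a ha
    obtain ⟨f, -, ha⟩ := Finset.mem_biUnion.1 ha
    exact (hK f a ha).1
  · refine le_trans ?_ (sum_fam_le_fam_biUnion w (fun f _ a ha => (hK f a ha).2.1) x)
    refine Finset.sum_le_sum fun f _ => ?_
    by_cases h : (x.support.filter (Seg F f)).Nonempty
    · have hKf : K f = {(x.support.filter (Seg F f)).min' h} := by simp only [K, dif_pos h]
      unfold fam
      rw [hKf, Finset.sum_singleton]
      refine tsNorm_le_of_abs_le w fun b => ?_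
      simp only [Finsupp.filter_apply]
      split_ifs with h1 h2 <;> try simp
      by_contra hb
      refine h2 ⟨Finset.min'_le _ _ ?_, by simp⟩
      simp [h1, hb]
    · have : x.filter (Seg F f) = 0 := by
        rw [Finsupp.filter_eq_zero_iff]
        intro b hb
        by_contra hne
        exact h ⟨b, by simp [hb, hne]⟩
      rw [this, tsNorm_zero, fam_zero]

theorem exists_max_fam (n : ℕ) (x : ℕ+ →₀ ℝ) :
    ∃ F ∈ Schreier n, F ⊆ x.support ∧ ∀ F' ∈ Schreier n, fam w F' x ≤ fam w F x := by
  classical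
  obtain ⟨F, hF, hmax⟩ := Finset.exists_max_image
    (x.support.powerset.filter (· ∈ Schreier n)) (fun F => fam w F x)
    ⟨∅, by simp [empty_mem_schreier]⟩
  simp only [Finset.mem_filter, Finset.mem_powerset] at hF hmax
  refine ⟨F, hF.2, hF.1, fun F' hF' => ?_⟩
  obtain ⟨F'', h1, h2, h3⟩ := exists_subset_support w hF' x
  exact h3.trans (hmax F'' ⟨h2, h1⟩)

theorem exists_max_sum_abs (n : ℕ) (x : ℕ+ →₀ ℝ) :
    ∃ F ∈ Schreier n, F ⊆ x.support ∧
      ∀ F' ∈ Schreier n, ∑ i ∈ F', |x i| ≤ ∑ i ∈ F, |x i| := by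
  classical
  obtain ⟨F, hF, hmax⟩ := Finset.exists_max_image
    (x.support.powerset.filter (· ∈ Schreier n)) (fun F => ∑ i ∈ F, |x i|)
    ⟨∅, by simp [empty_mem_schreier]⟩
  simp only [Finset.mem_filter, Finset.mem_powerset] at hF hmax
  refine ⟨F, hF.2, hF.1, fun F' hF' => ?_⟩
  have h := hmax (F'.filter (· ∈ x.support))
    ⟨fun a ha => (Finset.mem_filter.1 ha).2, schreier_hereditary hF' (Finset.filter_subset _ _)⟩
  refine le_trans (le_of_eq ?_) h
  refine (Finset.sum_subset (Finset.filter_subset _ _) fun i hi hn => ?_).symm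
  rw [Finset.mem_filter, not_and] at hn
  rw [Finsupp.notMem_support_iff.1 (hn hi), abs_zero]

/-! ### Vectors that are small on Schreier sets -/

section Flat

variable (w : Weights) {θ : ℝ}

/-- The spare factor `θ` pays for `φ n ≥ θ`; it also allows `n = 0`, where the family has at most
one interval. -/
theorem pow_mul_fam_le_tsNorm (hθ₁ : θ ≤ 1) (hlo : ∀ n : ℕ+, θ ^ ((n : ℕ) + 1) ≤ w n)
    (n : ℕ) {F : Finset ℕ+} (hF : F ∈ Schreier n) (x : ℕ+ →₀ ℝ) :
    θ ^ (n + 1) * fam w F x ≤ tsNorm w x := by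
  rcases Nat.eq_zero_or_pos n with rfl | hn
  · have h1 : fam w F x ≤ tsNorm w x := by
      have hF' : F.card ≤ 1 := hF
      rcases Finset.card_le_one_iff_subset_singleton.1 hF' with ⟨f, hf⟩
      rcases Finset.subset_singleton_iff.1 hf with rfl | rfl
      · simpa [fam] using tsNorm_nonneg w x
      · rw [fam, Finset.sum_singleton]
        refine tsNorm_le_of_abs_le w fun i => ?_
        rw [Finsupp.filter_apply]
        split_ifs <;> simp
    rw [zero_add, pow_one]
    exact (mul_le_of_le_one_left (fam_nonneg w F x) hθ₁).trans h1
  · exact (mul_le_mul_of_nonneg_right (hlo ⟨n, hn⟩) (fam_nonneg w F x)).trans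
      (mul_fam_le_tsNorm w ⟨n, hn⟩ hF x)

/-- For a norming family of order `n`, compare `n` with `m`. A long family factors through `S_m`; a
short one is completed to order `m` by induction on each of its intervals. The constant `θ⁻¹` does
not accumulate, since the outer weight is at most `θ ^ n`. -/
theorem tsNorm_le_of_fam_le_of_sum_le (hθ₀ : 0 < θ) (hθ₁ : θ ≤ 1)
    (hup : ∀ n : ℕ+, w n ≤ θ ^ (n : ℕ)) (hlo : ∀ n : ℕ+, θ ^ ((n : ℕ) + 1) ≤ w n)
    (m : ℕ) (x : ℕ+ →₀ ℝ) (a b : ℝ) (ha : ∀ F ∈ Schreier m, fam w F x ≤ a)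
    (hb : ∀ F ∈ Schreier m, ∑ i ∈ F, |x i| ≤ b) :
    tsNorm w x ≤ θ⁻¹ * (θ ^ m * a) + b := by
  induction m using Nat.strong_induction_on generalizing x a b with
  | _ m ih =>
  have ha0 : 0 ≤ a := (fam_nonneg w _ x).trans (ha _ (empty_mem_schreier m))
  have hb0 : 0 ≤ b := by simpa using hb _ (empty_mem_schreier m)
  refine tsNorm_le_of_fam w (fun i => ?_) fun n F hF => ?_
  · have := hb _ (singleton_mem_schreier m i)
    rw [Finset.sum_singleton] at this
    exact this.trans (le_add_of_nonneg_left (by positivity))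
  rcases le_or_gt m n with hmn | hmn
  -- Split `F` as `S_m[S_k]`; each inner `S_k`-family is dominated by the norm on its interval, at
  -- the price of `θ ^ (k + 1)`.
  · obtain ⟨k, hk⟩ := Nat.exists_eq_add_of_le hmn
    rw [hk] at hF
    obtain ⟨G, hG, hGF, hcov, hpc⟩ := schreier_add_decomp hF
    have h1 : θ ^ (k + 1) * fam w F x ≤ a := by
      calc θ ^ (k + 1) * fam w F x
          ≤ θ ^ (k + 1) * ∑ g ∈ G, fam w (F.filter (Seg G g)) (x.filter (Seg G g)) :=
            mul_le_mul_of_nonneg_left (fam_le_sum_fam w hGF hcov x) (by positivity)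
        _ ≤ fam w G x := by
            rw [Finset.mul_sum]
            exact Finset.sum_le_sum fun g hg =>
              pow_mul_fam_le_tsNorm w hθ₁ hlo k (hpc g hg) _
        _ ≤ a := ha G hG
    have h2 : w n * fam w F x ≤ θ ^ (m + k) * fam w F x :=
      mul_le_mul_of_nonneg_right (hk ▸ hup n) (fam_nonneg w F x)
    have h3 : θ ^ (m + k) * fam w F x = θ⁻¹ * (θ ^ m * (θ ^ (k + 1) * fam w F x)) := by
      rw [pow_add, pow_succ]
      field_simp
    rw [h3] at h2
    have h4 : θ⁻¹ * (θ ^ m * (θ ^ (k + 1) * fam w F x)) ≤ θ⁻¹ * (θ ^ m * a) := by gcongr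
    linarith
  -- Here `k < m` because `n ≥ 1`. Optimal sets of order `k` in the intervals of `F` glue to sets of
  -- order `m`, so the local bounds add up to at most `a` and `b`.
  · obtain ⟨k, hk⟩ := Nat.exists_eq_add_of_le hmn.le
    have hkm : k < m := by have := n.pos; omega
    choose A hA hAs hAm using fun f => exists_max_fam w k (x.filter (Seg F f))
    choose B hB hBs hBm using fun f => exists_max_sum_abs k (x.filter (Seg F f))
    have hAseg : ∀ f ∈ F, ∀ c ∈ A f, Seg F f c := fun f _ c hc => by
      have := hAs f hc
      rw [Finsupp.support_filter] at this
      exact (Finset.mem_filter.1 this).2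
    have hBseg : ∀ f ∈ F, ∀ c ∈ B f, Seg F f c := fun f _ c hc => by
      have := hBs f hc
      rw [Finsupp.support_filter] at this
      exact (Finset.mem_filter.1 this).2
    have h1 : ∑ f ∈ F, fam w (A f) (x.filter (Seg F f)) ≤ a :=
      (sum_fam_le_fam_biUnion w hAseg x).trans
        (ha _ (hk ▸ biUnion_mem_schreier hF (fun f _ => hA f) hAseg))
    have h2 : ∑ f ∈ F, ∑ i ∈ B f, |x.filter (Seg F f) i| ≤ b := by
      refine le_trans (le_of_eq ?_)
        (hb _ (hk ▸ biUnion_mem_schreier hF (fun f _ => hB f) hBseg))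
      rw [Finset.sum_biUnion]
      · refine Finset.sum_congr rfl fun f hf => Finset.sum_congr rfl fun i hi => ?_
        rw [Finsupp.filter_apply, if_pos (hBseg f hf i hi)]
      · intro f hf g hg hne
        rw [Function.onFun, Finset.disjoint_left]
        intro c hc hc'
        exact hne ((hBseg f hf c hc).unique hf hg (hBseg g hg c hc'))
    have h3 : fam w F x ≤ θ⁻¹ * (θ ^ k * ∑ f ∈ F, fam w (A f) (x.filter (Seg F f))) +
        ∑ f ∈ F, ∑ i ∈ B f, |x.filter (Seg F f) i| := by
      rw [Finset.mul_sum, Finset.mul_sum, ← Finset.sum_add_distrib]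
      exact Finset.sum_le_sum fun f _ => ih k hkm _ _ _ (hAm f) (hBm f)
    have h4 : fam w F x ≤ θ⁻¹ * (θ ^ k * a) + b := h3.trans (by gcongr)
    have h5 : w n * fam w F x ≤ θ ^ (n : ℕ) * (θ⁻¹ * (θ ^ k * a) + b) :=
      mul_le_mul (hup n) h4 (fam_nonneg w F x) (by positivity)
    have h6 : θ ^ (n : ℕ) * b ≤ b := mul_le_of_le_one_left hb0 (pow_le_one₀ hθ₀.le hθ₁)
    have h7 : θ ^ (n : ℕ) * (θ⁻¹ * (θ ^ k * a) + b) =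
        θ⁻¹ * (θ ^ m * a) + θ ^ (n : ℕ) * b := by
      rw [hk, pow_add]
      ring
    linarith

end Flat

/-! ### Block sequences -/

/-- The support of `x` is contained in `[α, β)`. -/
def SuppIn (α β : ℕ+) (x : ℕ+ →₀ ℝ) : Prop := ∀ i, x i ≠ 0 → α ≤ i ∧ i < β

theorem SuppIn.mono {α β α' β' : ℕ+} {x : ℕ+ →₀ ℝ} (h : SuppIn α β x) (h1 : α' ≤ α)
    (h2 : β ≤ β') : SuppIn α' β' x :=
  fun i hi => ⟨h1.trans (h i hi).1, (h i hi).2.trans_le h2⟩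

theorem SuppIn.smul {α β : ℕ+} {x : ℕ+ →₀ ℝ} (h : SuppIn α β x) (c : ℝ) : SuppIn α β (c • x) :=
  fun i hi => h i fun h0 => hi (by simp [h0])

theorem SuppIn.sum {ι : Type*} {α β : ℕ+} {s : Finset ι} {x : ι → ℕ+ →₀ ℝ}
    (h : ∀ c ∈ s, SuppIn α β (x c)) : SuppIn α β (∑ c ∈ s, x c) := by
  intro i hi
  rw [Finsupp.finsetSum_apply] at hi
  obtain ⟨c, hc, hne⟩ := Finset.exists_ne_zero_of_sum_ne_zero hi
  exact h c hc i hne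

theorem SuppIn.of_mem_span {α β : ℕ+} {S : Set (ℕ+ →₀ ℝ)} (hS : ∀ x ∈ S, SuppIn α β x)
    {y : ℕ+ →₀ ℝ} (hy : y ∈ Submodule.span ℝ S) : SuppIn α β y := by
  have h : Submodule.span ℝ S ≤ Finsupp.supported ℝ ℝ (Set.Ico α β) := by
    rw [Submodule.span_le]
    intro x hx i hi
    exact hS x hx i (by simpa using hi)
  intro i hi
  exact h hy (by simpa using hi)

theorem sum_apply_of_suppIn {α : ℕ → ℕ+} (hα : Monotone α) {y : ℕ → ℕ+ →₀ ℝ}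
    {s : Finset ℕ} (hy : ∀ c ∈ s, SuppIn (α c) (α (c + 1)) (y c)) {c : ℕ} (hc : c ∈ s) {i : ℕ+}
    (h1 : α c ≤ i) (h2 : i < α (c + 1)) : (∑ c ∈ s, y c) i = y c i := by
  rw [Finsupp.finsetSum_apply]
  refine Finset.sum_eq_single_of_mem c hc fun d hd hne => ?_
  by_contra h0
  have h3 := hy d hd i h0
  rcases lt_or_gt_of_ne hne with h | h
  · exact absurd (h3.2.trans_le (hα (show d + 1 ≤ c from h))) (not_lt.2 h1)
  · exact absurd (h2.trans_le (hα (show c + 1 ≤ d from h))) (not_lt.2 h3.1)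

/-- `X` is a normalized block sequence in `c₀₀`, with the support of `X k` in
`[σ k, σ (k + 1))`. -/
structure IsBlock (w : Weights) (σ : ℕ → ℕ+) (X : ℕ → ℕ+ →₀ ℝ) : Prop where
  mono : StrictMono σ
  supp : ∀ k, SuppIn (σ k) (σ (k + 1)) (X k)
  norm : ∀ k, tsNorm w (X k) = 1

theorem le_of_strictMono_pnat {σ : ℕ → ℕ+} (h : StrictMono σ) (k : ℕ) : k ≤ σ k :=
  StrictMono.le_apply (f := fun k => (σ k : ℕ)) (fun _ _ hlt => h hlt)

theorem IsBlock.suppIn_of_mem_span {w : Weights} {σ : ℕ → ℕ+} {X : ℕ → ℕ+ →₀ ℝ}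
    (hX : IsBlock w σ X) {k l : ℕ} {y : ℕ+ →₀ ℝ}
    (hy : y ∈ Submodule.span ℝ (X '' Set.Ico k l)) : SuppIn (σ k) (σ l) y := by
  refine SuppIn.of_mem_span ?_ hy
  rintro _ ⟨j, hj, rfl⟩
  exact (hX.supp j).mono (hX.mono.monotone hj.1) (hX.mono.monotone (Nat.succ_le_of_lt hj.2))

/-! ### Flat vectors in the span of a block sequence -/

section Flat

variable (w : Weights) {θ : ℝ}

theorem mul_card_le_tsNorm_sum (hθ₁ : θ ≤ 1)
    (hlo : ∀ n : ℕ+, θ ^ ((n : ℕ) + 1) ≤ w n) {α : ℕ → ℕ+} (hα : StrictMono α)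
    {y : ℕ → ℕ+ →₀ ℝ} (hy : ∀ c, SuppIn (α c) (α (c + 1)) (y c))
    (hn : ∀ c, tsNorm w (y c) = 1) {N : ℕ} (hN : N ≤ α 0) :
    θ ^ 2 * N ≤ tsNorm w (∑ c ∈ Finset.range N, y c) := by
  set F := (Finset.range N).image α
  have hF : F ∈ Schreier 1 := by
    rw [schreier_one]
    intro a ha
    obtain ⟨c, -, rfl⟩ := Finset.mem_image.1 ha
    calc F.card ≤ (Finset.range N).card := Finset.card_image_le
      _ = N := Finset.card_range N
      _ ≤ α 0 := hN
      _ ≤ α c := hα.monotone (Nat.zero_le c)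
  refine le_trans ?_ (pow_mul_fam_le_tsNorm w hθ₁ hlo 1 hF _)
  refine mul_le_mul_of_nonneg_left ?_ (by positivity)
  unfold fam
  rw [Finset.sum_image fun i _ j _ h => hα.injective h]
  calc (N : ℝ) = ∑ c ∈ Finset.range N, (1 : ℝ) := by simp
    _ ≤ _ := Finset.sum_le_sum fun c hc => ?_
  rw [← hn c]
  refine tsNorm_le_of_abs_le w fun i => ?_
  by_cases h0 : y c i = 0
  · simp [h0]
  have h1 := hy c i h0
  rw [Finsupp.filter_apply, if_pos, sum_apply_of_suppIn hα.monotone (fun c _ => hy c) hc h1.1 h1.2]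
  refine ⟨h1.1, fun g hg hlt => ?_⟩
  obtain ⟨d, -, rfl⟩ := Finset.mem_image.1 hg
  exact h1.2.trans_le (hα.monotone (Nat.succ_le_of_lt (hα.lt_iff_lt.1 hlt)))

/-- The windows are disjoint, so the extra cost `C` is paid at most once. -/
theorem sum_abs_sum_le {α : ℕ → ℕ+} (hα : StrictMono α) {y : ℕ → ℕ+ →₀ ℝ} {N : ℕ} (hN : 0 < N)
    {C : ℝ} (hC : 0 ≤ C) {F : Finset ℕ+} {m : ℕ+}
    (h : ∀ c < N, ∑ i ∈ F, |y c i| ≤ 1 / N + if α c ≤ m ∧ m < α (c + 1) then C else 0) :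
    ∑ i ∈ F, |(∑ c ∈ Finset.range N, y c) i| ≤ 1 + C := by
  have h1 : ∑ i ∈ F, |(∑ c ∈ Finset.range N, y c) i| ≤
      ∑ c ∈ Finset.range N, ∑ i ∈ F, |y c i| := by
    rw [Finset.sum_comm]
    refine Finset.sum_le_sum fun i _ => ?_
    rw [Finsupp.finsetSum_apply]
    exact Finset.abs_sum_le_sum_abs _ _
  have h2 : ∑ c ∈ Finset.range N, (if α c ≤ m ∧ m < α (c + 1) then C else 0) ≤ C := by
    rw [← Finset.sum_filter, Finset.sum_const, nsmul_eq_mul]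
    refine mul_le_of_le_one_left hC ?_
    have : ((Finset.range N).filter fun c => α c ≤ m ∧ m < α (c + 1)).card ≤ 1 := by
      refine Finset.card_le_one.2 fun c hc d hd => ?_
      rw [Finset.mem_filter] at hc hd
      have h3 := hα.lt_iff_lt.1 (hc.2.1.trans_lt hd.2.2)
      have h4 := hα.lt_iff_lt.1 (hd.2.1.trans_lt hc.2.2)
      omega
    exact_mod_cast this
  refine (h1.trans (Finset.sum_le_sum fun c hc => h c (Finset.mem_range.1 hc))).trans ?_
  rw [Finset.sum_add_distrib]
  have hN' : (N : ℝ) ≠ 0 := by positivity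
  have h3 : ∑ _c ∈ Finset.range N, 1 / (N : ℝ) = 1 := by
    rw [Finset.sum_const, Finset.card_range, nsmul_eq_mul]
    field_simp
  linarith

/-- Every tail of `X` has a normalized vector in its span that is small on the sets of
`S_M`. -/
def HasFlatBlocks (X : ℕ → ℕ+ →₀ ℝ) (M : ℕ) : Prop :=
  ∀ ε : ℝ, 0 < ε → ∀ k₀ : ℕ, ∃ k₁ > k₀,
    ∃ Y ∈ Submodule.span ℝ (X '' Set.Ico k₀ k₁), tsNorm w Y = 1 ∧
      ∀ F ∈ Schreier M, ∑ i ∈ F, |Y i| ≤ ε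

/-- Add `N` of the blocks `y c`: the norm is at least `θ ^ 2 * N` because the family is
`S_1`-admissible, while the sums over `S_M`-sets stay below `1 + C`. Normalizing makes the latter
small. -/
theorem IsBlock.hasFlatBlocks_of_bounded (hθ₀ : 0 < θ) (hθ₁ : θ ≤ 1)
    (hlo : ∀ n : ℕ+, θ ^ ((n : ℕ) + 1) ≤ w n) {σ : ℕ → ℕ+} {X : ℕ → ℕ+ →₀ ℝ}
    (hX : IsBlock w σ X) {M : ℕ} {C : ℝ} (hC : 0 ≤ C)
    (h : ∀ N : ℕ, 0 < N → ∀ k₀, ∃ κ : ℕ → ℕ, StrictMono κ ∧ k₀ ≤ κ 0 ∧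
      N ≤ σ (κ 0) ∧ ∃ y : ℕ → ℕ+ →₀ ℝ,
        (∀ c, y c ∈ Submodule.span ℝ (X '' Set.Ico (κ c) (κ (c + 1)))) ∧
        (∀ c, tsNorm w (y c) = 1) ∧ ∀ F ∈ Schreier M, ∀ m ∈ F, (∀ i ∈ F, m ≤ i) → ∀ c < N,
          ∑ i ∈ F, |y c i| ≤
            1 / N + if σ (κ c) ≤ m ∧ m < σ (κ (c + 1)) then C else 0) :
    HasFlatBlocks w X M := by
  intro ε hε k₀
  obtain ⟨N, hN⟩ := exists_nat_gt ((1 + C) / (θ ^ 2 * ε))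
  have hNpos : 0 < (N : ℝ) := lt_of_le_of_lt (by positivity) hN
  have hN0 : 0 < N := by exact_mod_cast hNpos
  obtain ⟨κ, hκ, hk₀, hNσ, y, hy, hyn, hyF⟩ := h N hN0 k₀
  set S := ∑ c ∈ Finset.range N, y c with hS
  have hα : StrictMono fun c => σ (κ c) := hX.mono.comp hκ
  have hS1 : θ ^ 2 * N ≤ tsNorm w S := mul_card_le_tsNorm_sum w hθ₁ hlo hα
    (fun c => hX.suppIn_of_mem_span (hy c)) hyn hNσ
  have hSpos : 0 < tsNorm w S := lt_of_lt_of_le (by positivity) hS1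
  refine ⟨κ N, lt_of_le_of_lt hk₀ (hκ hN0), (tsNorm w S)⁻¹ • S, ?_, ?_, fun F hF => ?_⟩
  · refine Submodule.smul_mem _ _ (Submodule.sum_mem _ fun c hc => ?_)
    refine Submodule.span_mono (Set.image_mono (Set.Ico_subset_Ico ?_ ?_)) (hy c)
    · exact hk₀.trans (hκ.monotone (Nat.zero_le c))
    · exact hκ.monotone (Nat.succ_le_of_lt (Finset.mem_range.1 hc))
  · rw [tsNorm_smul, abs_of_pos (inv_pos.2 hSpos), inv_mul_cancel₀ hSpos.ne']
  · have h1 : ∑ i ∈ F, |S i| ≤ 1 + C := by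
      rcases F.eq_empty_or_nonempty with rfl | hne
      · simp only [Finset.sum_empty]
        positivity
      · exact sum_abs_sum_le hα hN0 hC
          (hyF F hF _ (F.min'_mem hne) fun i hi => F.min'_le i hi)
    have h2 : ∑ i ∈ F, |((tsNorm w S)⁻¹ • S) i| = (tsNorm w S)⁻¹ * ∑ i ∈ F, |S i| := by
      rw [Finset.mul_sum]
      refine Finset.sum_congr rfl fun i _ => ?_
      rw [Finsupp.smul_apply, smul_eq_mul, abs_mul, abs_of_pos (inv_pos.2 hSpos)]
    rw [h2, inv_mul_le_iff₀ hSpos]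
    refine h1.trans (le_trans ?_ (mul_le_mul_of_nonneg_right hS1 hε.le))
    rw [div_lt_iff₀ (by positivity)] at hN
    linarith

/-- Induction on `M`: a set of `S_{M+1}` starting before a block is a union of few `S_M`-sets there,
their number being bounded by the left end of the block, whereas only one block can contain its
minimum. -/
theorem IsBlock.hasFlatBlocks (hθ₀ : 0 < θ) (hθ₁ : θ ≤ 1)
    (hlo : ∀ n : ℕ+, θ ^ ((n : ℕ) + 1) ≤ w n) {σ : ℕ → ℕ+} {X : ℕ → ℕ+ →₀ ℝ}
    (hX : IsBlock w σ X) (M : ℕ) : HasFlatBlocks w X M := by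
  induction M with
  | zero =>
    refine hX.hasFlatBlocks_of_bounded w hθ₀ hθ₁ hlo zero_le_one fun N hN k₀ => ?_
    refine ⟨fun c => max k₀ N + c, fun a b h => by simpa using h, by simp,
      (le_max_right k₀ N).trans (by simpa using le_of_strictMono_pnat hX.mono (max k₀ N)),
      fun c => X (max k₀ N + c),
      fun c => Submodule.subset_span ⟨_, ⟨le_rfl, Nat.lt_succ_self (max k₀ N + c)⟩, rfl⟩, fun c => hX.norm _, ?_⟩
    intro F hF m hm _ c _
    have hF' : F = {m} := Finset.eq_singleton_iff_unique_mem.2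
      ⟨hm, fun b hb => Finset.card_le_one.1 hF b hb m hm⟩
    rw [hF', Finset.sum_singleton]
    split_ifs with h
    · have := abs_le_tsNorm w (X (max k₀ N + c)) m
      rw [hX.norm] at this
      have h0 : 0 ≤ 1 / (N : ℝ) := by positivity
      linarith
    · have : X (max k₀ N + c) m = 0 := by
        by_contra h0
        exact h (hX.supp _ m h0)
      rw [this, abs_zero]
      positivity
  | succ M ih =>
    refine hX.hasFlatBlocks_of_bounded w hθ₀ hθ₁ hlo (C := (θ ^ (M + 1 + 1))⁻¹) (by positivity)
      fun N hN k₀ => ?_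
    have hNpos : 0 < (N : ℝ) := by exact_mod_cast hN
    have hσpos : ∀ k, 0 < ((σ k : ℕ) : ℝ) := fun k => by exact_mod_cast (σ k).pos
    -- The tolerance is divided by `σ k` since up to `σ k` sets of `S_M` may have to be summed over
    -- the block.
    choose r hr Y hY hYn hYF using fun k : ℕ =>
      ih (1 / (N * (σ k : ℕ))) (one_div_pos.2 (mul_pos hNpos (hσpos k))) k
    let κ : ℕ → ℕ := fun c => r^[c] (max k₀ N)
    have hκs : ∀ c, κ (c + 1) = r (κ c) := fun c => Function.iterate_succ_apply' r c _
    have hκ : StrictMono κ := strictMono_nat_of_lt_succ fun c => by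
      rw [hκs]
      exact hr _
    have hα : StrictMono fun c => σ (κ c) := hX.mono.comp hκ
    refine ⟨κ, hκ, le_max_left _ _, (le_max_right k₀ N).trans (le_of_strictMono_pnat hX.mono _),
      fun c => Y (κ c), fun c => ?_, fun c => hYn _, ?_⟩
    · rw [hκs]
      exact hY _
    intro F hF m hm hmin c _
    have hsupp : SuppIn (σ (κ c)) (σ (κ (c + 1))) (Y (κ c)) := by
      rw [hκs]
      exact hX.suppIn_of_mem_span (hY _)
    rcases lt_or_ge m (σ (κ c)) with hlt | hge
    · rw [if_neg fun h => absurd hlt (not_lt.2 h.1), add_zero]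
      obtain ⟨G, hG, hGF, hcov, hpc⟩ := schreier_succ_decomp hF
      have hmG : m ∈ G := by
        obtain ⟨g, hg, hgm⟩ := hcov m hm
        exact le_antisymm hgm (hmin g (hGF hg)) ▸ hg
      have hGc : (G.card : ℝ) ≤ (σ (κ c) : ℕ) := by
        exact_mod_cast (hG m hmG).trans (show (m : ℕ) ≤ σ (κ c) from hlt.le)
      have h1 : ∑ i ∈ F, |Y (κ c) i| ≤ ∑ g ∈ G, ∑ i ∈ F.filter (Seg G g), |Y (κ c) i| := by
        rw [← Finset.sum_biUnion]
        · refine Finset.sum_le_sum_of_subset_of_nonneg (fun a ha => ?_) fun _ _ _ => abs_nonneg _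
          obtain ⟨g, hg, hs⟩ := exists_seg (hcov a ha)
          exact Finset.mem_biUnion.2 ⟨g, hg, Finset.mem_filter.2 ⟨ha, hs⟩⟩
        · intro f hf g hg hne
          rw [Function.onFun, Finset.disjoint_left]
          intro a ha ha'
          exact hne ((Finset.mem_filter.1 ha).2.unique hf hg (Finset.mem_filter.1 ha').2)
      refine (h1.trans (Finset.sum_le_sum fun g hg => hYF _ _ (hpc g hg))).trans ?_
      rw [Finset.sum_const, nsmul_eq_mul]
      calc (G.card : ℝ) * (1 / (N * (σ (κ c) : ℕ)))
          ≤ (σ (κ c) : ℕ) * (1 / (N * (σ (κ c) : ℕ))) :=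
            mul_le_mul_of_nonneg_right hGc (one_div_pos.2 (mul_pos hNpos (hσpos _))).le
        _ = 1 / N := by
            have := (hσpos (κ c)).ne'
            field_simp
    rcases lt_or_ge m (σ (κ (c + 1))) with hlt | hge'
    · rw [if_pos ⟨hge, hlt⟩]
      have h1 : ∑ i ∈ F, |Y (κ c) i| ≤ fam w F (Y (κ c)) := by
        refine Finset.sum_le_sum fun i _ => ?_
        refine le_trans (le_of_eq ?_) (abs_le_tsNorm w _ i)
        rw [Finsupp.filter_apply, if_pos ⟨le_rfl, fun _ _ h => h⟩]
      have h2 := pow_mul_fam_le_tsNorm w hθ₁ hlo (M + 1) hF (Y (κ c))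
      rw [hYn] at h2
      have h3 : fam w F (Y (κ c)) ≤ (θ ^ (M + 1 + 1))⁻¹ := by
        rwa [← one_div, le_div_iff₀' (by positivity)]
      have h0 : 0 ≤ 1 / (N : ℝ) := by positivity
      linarith
    · have h0 : ∑ i ∈ F, |Y (κ c) i| = 0 := Finset.sum_eq_zero fun i hi => by
        by_contra hne
        have := (hsupp i fun h => hne (by rw [h, abs_zero])).2
        exact absurd (this.trans_le hge') (not_lt.2 (hmin i hi))
      rw [h0]
      split_ifs <;> positivity

end Flat

/-! ### Averages of block vectors -/

section Average

variable (w : Weights)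

/-- `F` is covered by at most `p` sets from `S_n`. -/
def CoveredBy (p n : ℕ) (F : Finset ℕ+) : Prop :=
  ∃ 𝓒 : Finset (Finset ℕ+), 𝓒.card ≤ p ∧ (∀ C ∈ 𝓒, C ∈ Schreier n) ∧ F ⊆ 𝓒.biUnion id

theorem coveredBy_of_mem {n : ℕ} {F : Finset ℕ+} (hF : F ∈ Schreier n) : CoveredBy 1 n F :=
  ⟨{F}, by simp, by simpa using hF, by simp⟩

theorem CoveredBy.card_le {p : ℕ} {F : Finset ℕ+} (h : CoveredBy p 0 F) : F.card ≤ p := by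
  obtain ⟨𝓒, h1, h2, h3⟩ := h
  calc F.card ≤ (𝓒.biUnion id).card := Finset.card_le_card h3
    _ ≤ 𝓒.card * 1 := Finset.card_biUnion_le_card_mul _ _ _ fun C hC => h2 C hC
    _ ≤ p := by simpa using h1

theorem exists_cover_of_mem_succ {n : ℕ} {C : Finset ℕ+} (hC : C ∈ Schreier (n + 1)) :
    ∃ 𝓠 : Finset (Finset ℕ+), (∀ a ∈ C, 𝓠.card ≤ a) ∧ (∀ A ∈ 𝓠, A ∈ Schreier n) ∧
      C ⊆ 𝓠.biUnion id := by
  obtain ⟨G, hG, -, hcov, hpc⟩ := schreier_succ_decomp hC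
  refine ⟨G.image fun g => C.filter (Seg G g), fun a ha => ?_, fun A hA => ?_, fun a ha => ?_⟩
  · obtain ⟨g, hg, hga⟩ := hcov a ha
    exact Finset.card_image_le.trans ((hG g hg).trans hga)
  · obtain ⟨g, hg, rfl⟩ := Finset.mem_image.1 hA
    exact hpc g hg
  · obtain ⟨g, hg, hs⟩ := exists_seg (hcov a ha)
    exact Finset.mem_biUnion.2 ⟨_, Finset.mem_image_of_mem _ hg, Finset.mem_filter.2 ⟨ha, hs⟩⟩

/-- At most one element of `F` outside the open window has a segment meeting the support of `x`,
namely the last one not exceeding `α`; the point `α` takes its place. -/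
theorem fam_le_fam_window (F : Finset ℕ+) {α β : ℕ+} {x : ℕ+ →₀ ℝ} (hx : SuppIn α β x) :
    fam w F x ≤ fam w (insert α (F.filter fun f => α < f ∧ f < β)) x := by
  set F' := insert α (F.filter fun f => α < f ∧ f < β) with hF'
  have h1 : fam w F' x = tsNorm w (x.filter (Seg F' α)) +
      ∑ f ∈ F.filter (fun f => α < f ∧ f < β), tsNorm w (x.filter (Seg F' f)) := by
    unfold fam
    conv_lhs => rw [hF']
    rw [Finset.sum_insert (by simp)]
  have h2 : fam w F x = ∑ f ∈ F.filter (fun f => α < f ∧ f < β), tsNorm w (x.filter (Seg F f)) +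
      ∑ f ∈ F.filter (fun f => ¬ (α < f ∧ f < β)), tsNorm w (x.filter (Seg F f)) :=
    (Finset.sum_filter_add_sum_filter_not _ _ _).symm
  rw [h1, h2, add_comm]
  refine add_le_add ?_ (Finset.sum_le_sum fun f hf => ?_)
  · by_cases h : ∃ f ∈ F.filter (fun f => ¬ (α < f ∧ f < β)), x.filter (Seg F f) ≠ 0
    · obtain ⟨f, hf, hne⟩ := h
      have key : ∀ f ∈ F.filter (fun f => ¬ (α < f ∧ f < β)), ∀ b, x b ≠ 0 → Seg F f b →
          f ≤ α := by
        intro f hf b hb hs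
        by_contra hlt
        exact (Finset.mem_filter.1 hf).2 ⟨not_le.1 hlt, hs.1.trans_lt (hx b hb).2⟩
      have hb : ∃ b, x b ≠ 0 ∧ Seg F f b := by
        by_contra hcon
        push Not at hcon
        refine hne (Finsupp.filter_eq_zero_iff _ _ |>.2 fun b hb => ?_)
        by_contra h0
        exact hcon b h0 hb
      obtain ⟨b, hb, hs⟩ := hb
      have hfα := key f hf b hb hs
      rw [Finset.sum_eq_single_of_mem f hf]
      · refine tsNorm_le_of_abs_le w fun c => ?_
        by_cases hc : x c = 0
        · simp [Finsupp.filter_apply, hc]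
        simp only [Finsupp.filter_apply]
        split_ifs with h3 h4
        · exact le_rfl
        · refine (h4 ⟨(hx c hc).1, fun g hg hlt => ?_⟩).elim
          rcases Finset.mem_insert.1 hg with rfl | hg
          · exact absurd hlt (lt_irrefl _)
          · exact h3.2 g (Finset.mem_filter.1 hg).1 (hfα.trans_lt hlt)
        · simp
        · simp
      · intro f' hf' hne'
        rw [Finsupp.filter_eq_zero_iff _ _ |>.2, tsNorm_zero]
        intro c hc
        by_contra h0
        have hf'α := key f' hf' c h0 hc
        have m1 := (Finset.mem_filter.1 hf).1
        have m2 := (Finset.mem_filter.1 hf').1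
        rcases lt_or_gt_of_ne hne' with hlt | hlt
        · exact absurd (hc.2 f m1 hlt) (not_lt.2 (hfα.trans (hx c h0).1))
        · exact absurd (hs.2 f' m2 hlt) (not_lt.2 (hf'α.trans (hx b hb).1))
    · rw [Finset.sum_eq_zero]
      · exact tsNorm_nonneg w _
      · intro f hf
        rw [by_contra fun hne => h ⟨f, hf, hne⟩, tsNorm_zero]
  · have hf' := (Finset.mem_filter.1 hf).2
    refine tsNorm_le_of_abs_le w fun c => ?_
    simp only [Finsupp.filter_apply]
    split_ifs with h3 h4
    · exact le_rfl
    · refine (h4 ⟨h3.1, fun g hg hlt => ?_⟩).elim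
      rcases Finset.mem_insert.1 hg with rfl | hg
      · exact absurd hlt (not_lt.2 hf'.1.le)
      · exact h3.2 g (Finset.mem_filter.1 hg).1 hlt
    · simp
    · simp

/-- A point lies in only one window, so sending a marked window to an index whose point it contains
is injective. -/
theorem card_filter_window_le {ι : Type*} [Nonempty ι] {α : ℕ → ℕ+} (hα : StrictMono α)
    (s : Finset ℕ) (t : Finset ι) (μ : ι → ℕ+ → Prop)
    (hμ : ∀ j a b, μ j a → μ j b → a = b) (b : ℕ → Prop) [DecidablePred b]
    (hb : ∀ c, b c → ∃ j ∈ t, ∃ m, μ j m ∧ α c ≤ m ∧ m < α (c + 1)) :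
    (s.filter b).card ≤ t.card := by
  choose! j hj m hm hm1 hm2 using hb
  refine Finset.card_le_card_of_injOn j (fun c hc => hj c ?_) fun c hc d hd hcd => ?_
  · exact (Finset.mem_filter.1 (Finset.mem_coe.1 hc)).2
  · have hc' := (Finset.mem_filter.1 (Finset.mem_coe.1 hc)).2
    have hd' := (Finset.mem_filter.1 (Finset.mem_coe.1 hd)).2
    have heq : m c = m d := hμ (j c) _ _ (hm c hc') (hcd ▸ hm d hd')
    have h3 := hα.lt_iff_lt.1 ((hm1 c hc').trans_lt (heq ▸ hm2 d hd'))
    have h4 := hα.lt_iff_lt.1 ((hm1 d hd').trans_lt (heq ▸ hm2 c hc'))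
    omega

/-- Passing from a sum to its terms lowers the order by one. Unless a covering set starts inside
window `c`, all those meeting its interior start before `α c` and hence split into at most `α c`
sets of `S_n` each; the `+ 1` is for the point `α c`. At most `q` exceptional windows cost `D` each.
-/
theorem fam_sum_le_of_coveredBy {α : ℕ → ℕ+} (hα : StrictMono α) {y : ℕ → ℕ+ →₀ ℝ}
    (hy : ∀ c, SuppIn (α c) (α (c + 1)) (y c)) {D : ℝ} (hD : 0 ≤ D) (hyD : ∀ c, l1 (y c) ≤ D)
    {p n : ℕ} {B : ℝ}
    (hB : ∀ c, ∀ F, CoveredBy (p * α c + 1) n F → fam w F (y c) ≤ B)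
    {q : ℕ} (hq : q ≤ p) {F : Finset ℕ+} (hF : CoveredBy q (n + 1) F) (s : Finset ℕ) :
    fam w F (∑ c ∈ s, y c) ≤ s.card * B + q * D := by
  classical
  obtain ⟨𝓒, hcard, h𝓒, hF⟩ := hF
  set bad : ℕ → Prop := fun c => ∃ C ∈ 𝓒, ∃ m, IsLeast (C : Set ℕ+) m ∧ α c ≤ m ∧ m < α (c + 1)
  have hB0 : 0 ≤ B := (fam_nonneg w ∅ (y 0)).trans (hB 0 ∅ ⟨∅, by simp, by simp, by simp⟩)
  have hbad : (s.filter bad).card ≤ q := (card_filter_window_le hα s 𝓒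
    (fun C m => IsLeast (C : Set ℕ+) m) (fun _ _ _ h h' => h.unique h') bad
    (fun _ h => h)).trans hcard
  have hgood : ∀ c, ¬ bad c → fam w F (y c) ≤ B := by
    intro c hc
    refine (fam_le_fam_window w F (hy c)).trans (hB c _ ?_)
    choose! 𝓠 hP1 hP2 hP3 using fun C (hC : C ∈ 𝓒) => exists_cover_of_mem_succ (h𝓒 C hC)
    set 𝓒' := 𝓒.filter fun C => ∃ a ∈ C, a < α c
    refine ⟨insert {α c} (𝓒'.biUnion 𝓠), ?_, ?_, ?_⟩
    · refine (Finset.card_insert_le _ _).trans (Nat.succ_le_succ ?_)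
      refine (Finset.card_biUnion_le_card_mul _ _ (α c) fun C hC => ?_).trans
        (Nat.mul_le_mul_right _ ?_)
      · obtain ⟨hC, a, ha, hlt⟩ := Finset.mem_filter.1 hC
        exact (hP1 C hC a ha).trans (show (a : ℕ) ≤ α c from hlt.le)
      · exact ((Finset.card_le_card (Finset.filter_subset _ _)).trans hcard).trans hq
    · intro A hA
      rcases Finset.mem_insert.1 hA with rfl | hA
      · exact singleton_mem_schreier n _
      · obtain ⟨C, hC, hA⟩ := Finset.mem_biUnion.1 hA
        exact hP2 C (Finset.mem_filter.1 hC).1 A hA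
    · intro a ha
      rcases Finset.mem_insert.1 ha with rfl | ha
      · simp
      obtain ⟨haF, h1, h2⟩ := Finset.mem_filter.1 ha
      obtain ⟨C, hC, haC⟩ := Finset.mem_biUnion.1 (hF haF)
      have hl := Finset.isLeast_min' C ⟨a, haC⟩
      have hlt : C.min' ⟨a, haC⟩ < α c := by
        by_contra hge
        exact hc ⟨C, hC, _, hl, not_lt.1 hge, (hl.2 haC).trans_lt h2⟩
      obtain ⟨A, hA, haA⟩ := Finset.mem_biUnion.1 (hP3 C hC haC)
      refine Finset.mem_biUnion.2 ⟨A, Finset.mem_insert_of_mem (Finset.mem_biUnion.2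
        ⟨C, Finset.mem_filter.2 ⟨hC, _, hl.1, hlt⟩, hA⟩), haA⟩
  calc fam w F (∑ c ∈ s, y c) ≤ ∑ c ∈ s, fam w F (y c) := fam_sum_le w F s y
    _ ≤ ∑ c ∈ s, (B + if bad c then D else 0) := by
        refine Finset.sum_le_sum fun c _ => ?_
        split_ifs with h
        · exact ((fam_le_l1 w F _).trans (hyD c)).trans (le_add_of_nonneg_left hB0)
        · rw [add_zero]
          exact hgood c h
    _ = s.card * B + (s.filter bad).card * D := by
        rw [Finset.sum_add_distrib, ← Finset.sum_filter, Finset.sum_const, Finset.sum_const,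
          nsmul_eq_mul, nsmul_eq_mul]
    _ ≤ _ := by gcongr

theorem abs_le_l1_of_sum {α : ℕ → ℕ+} (hα : Monotone α) {y : ℕ → ℕ+ →₀ ℝ}
    (hy : ∀ c, SuppIn (α c) (α (c + 1)) (y c)) {D : ℝ} (hD : 0 ≤ D) (hyD : ∀ c, l1 (y c) ≤ D)
    (s : Finset ℕ) (i : ℕ+) : |(∑ c ∈ s, y c) i| ≤ D := by
  by_cases h : ∃ c ∈ s, y c i ≠ 0
  · obtain ⟨c, hc, h0⟩ := h
    have := hy c i h0
    rw [sum_apply_of_suppIn hα (fun c _ => hy c) hc this.1 this.2]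
    exact (abs_le_l1 _ i).trans (hyD c)
  · push Not at h
    rw [Finsupp.finsetSum_apply, Finset.sum_eq_zero h, abs_zero]
    exact hD

/-- With at most `p` cutting points, all but `p` blocks lie within one interval or outside all of
them. On each interval the norm is unfolded once, and a family of order `n + 1` meets the single
blocks with order `n`; the factor 2 counts exceptional blocks at both stages. -/
theorem fam_sum_le_of_card_le {α : ℕ → ℕ+} (hα : StrictMono α) {y : ℕ → ℕ+ →₀ ℝ}
    (hy : ∀ c, SuppIn (α c) (α (c + 1)) (y c)) {D : ℝ} (hD : 0 ≤ D) (hyD : ∀ c, l1 (y c) ≤ D)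
    {p : ℕ} (hp : 1 ≤ p) {B : ℕ → ℝ} {γ : ℝ} (hγ : 0 ≤ γ)
    (hB : ∀ c n, ∀ F, CoveredBy (p * α c + 1) n F → fam w F (y c) ≤ B n)
    (hBγ : ∀ n : ℕ, w n.succPNat * B n ≤ γ) {F : Finset ℕ+} (hF : F.card ≤ p) (N : ℕ) :
    fam w F (∑ c ∈ Finset.range N, y c) ≤ N * γ + 2 * p * D := by
  classical
  set bad : ℕ → Prop := fun c => ∃ f ∈ F, ∃ m, m = f ∧ α c ≤ m ∧ m < α (c + 1) with hbad_def
  have hbad : ((Finset.range N).filter bad).card ≤ p :=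
    (card_filter_window_le hα _ F (fun f m => m = f)
      (fun _ _ _ h h' => h.trans h'.symm) bad (fun _ h => h)).trans hF
  set good := (Finset.range N).filter fun c => ¬ bad c
  have hsplit : ∑ c ∈ Finset.range N, y c =
      ∑ c ∈ (Finset.range N).filter bad, y c + ∑ c ∈ good, y c :=
    (Finset.sum_filter_add_sum_filter_not _ _ _).symm
  have h1 : fam w F (∑ c ∈ (Finset.range N).filter bad, y c) ≤ p * D := by
    calc _ ≤ ∑ c ∈ (Finset.range N).filter bad, fam w F (y c) := fam_sum_le w F _ y
      _ ≤ ∑ _c ∈ (Finset.range N).filter bad, D :=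
          Finset.sum_le_sum fun c _ => (fam_le_l1 w F _).trans (hyD c)
      _ = ((Finset.range N).filter bad).card * D := by rw [Finset.sum_const, nsmul_eq_mul]
      _ ≤ p * D := by gcongr
  let gf : ℕ+ → Finset ℕ := fun f => good.filter fun c => Seg F f (α c)
  -- No cutting point meets the window of a good block, so restriction to the segment of `f` keeps
  -- the block whole or removes it, according to `α c`.
  have hgf : ∀ f ∈ F, (∑ c ∈ good, y c).filter (Seg F f) = ∑ c ∈ gf f, y c := by
    intro f hf
    have hsum : ∑ c ∈ gf f, y c = ∑ c ∈ good, if Seg F f (α c) then y c else 0 :=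
      Finset.sum_filter _ _
    rw [Finsupp.filter_sum, hsum]
    refine Finset.sum_congr rfl fun c hc => ?_
    have hcb := (Finset.mem_filter.1 hc).2
    have hiff : ∀ i, y c i ≠ 0 → ∀ g ∈ F, (g ≤ i ↔ g ≤ α c) := by
      intro i hi g hg
      refine ⟨fun h => ?_, fun h => h.trans (hy c i hi).1⟩
      by_contra hlt
      exact hcb ⟨g, hg, g, rfl, (not_le.1 hlt).le, h.trans_lt (hy c i hi).2⟩
    have hseg : ∀ i, y c i ≠ 0 → (Seg F f i ↔ Seg F f (α c)) := by
      intro i hi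
      unfold Seg
      rw [hiff i hi f hf]
      refine and_congr_right fun _ => forall_congr' fun g => forall_congr' fun hg => ?_
      rw [← not_le, ← not_le, ← not_le, hiff i hi g hg]
    ext i
    rw [Finsupp.filter_apply]
    by_cases hi : y c i = 0
    · split_ifs <;> simp [hi]
    · rw [if_congr (hseg i hi) rfl rfl]
      split_ifs <;> simp
  have h2 : ∀ f ∈ F, tsNorm w ((∑ c ∈ good, y c).filter (Seg F f)) ≤ (gf f).card * γ + D := by
    intro f hf
    rw [hgf f hf]
    refine tsNorm_le_of_fam w (fun i => ?_) fun n F₂ hF₂ => ?_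
    · exact (abs_le_l1_of_sum hα.monotone hy hD hyD _ i).trans
        (le_add_of_nonneg_left (by positivity))
    · obtain ⟨m, rfl⟩ : ∃ m : ℕ, n = m.succPNat := ⟨n.natPred, by simp⟩
      have h3 := fam_sum_le_of_coveredBy w hα hy hD hyD (fun c => hB c m) hp
        (coveredBy_of_mem (n := m + 1) hF₂) (gf f)
      have hw := w.pos' m.succPNat
      have hw1 := w.lt_one' m.succPNat
      calc w m.succPNat * fam w F₂ (∑ c ∈ gf f, y c)
          ≤ w m.succPNat * ((gf f).card * B m + (1 : ℕ) * D) := by gcongr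
        _ = (gf f).card * (w m.succPNat * B m) + w m.succPNat * D := by push_cast; ring
        _ ≤ (gf f).card * γ + 1 * D := by
            gcongr
            exact hBγ m
        _ = _ := by rw [one_mul]
  have h3 : ∑ f ∈ F, (gf f).card ≤ N := by
    rw [← Finset.card_biUnion]
    · refine (Finset.card_le_card (t := Finset.range N) fun c hc => ?_).trans
        (Finset.card_range N).le
      obtain ⟨f, -, hc⟩ := Finset.mem_biUnion.1 hc
      exact (Finset.mem_filter.1 (Finset.mem_filter.1 hc).1).1
    · intro f hf g hg hne
      rw [Function.onFun, Finset.disjoint_left]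
      intro c hc hc'
      exact hne ((Finset.mem_filter.1 hc).2.unique hf hg (Finset.mem_filter.1 hc').2)
  have h4 : fam w F (∑ c ∈ good, y c) ≤ N * γ + p * D := by
    calc fam w F (∑ c ∈ good, y c) ≤ ∑ f ∈ F, ((gf f).card * γ + D) := Finset.sum_le_sum h2
      _ = ((∑ f ∈ F, (gf f).card : ℕ) : ℝ) * γ + F.card * D := by
          rw [Finset.sum_add_distrib, ← Finset.sum_mul, Finset.sum_const, nsmul_eq_mul]
          push_cast
          rfl
      _ ≤ N * γ + p * D := by gcongr
  rw [hsplit]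
  have := fam_add_le w F (∑ c ∈ (Finset.range N).filter bad, y c) (∑ c ∈ good, y c)
  linarith

/-- The `N` window starts form an `S_1`-set because `N ≤ β 0`, so the local `S_n`-sets glue to one
of order `n + 1`. -/
theorem exists_fam_sum_ge {n N : ℕ} {β : ℕ → ℕ+} (hβ : StrictMono β) {v : ℕ → ℕ+ →₀ ℝ}
    (hv : ∀ c, SuppIn (β c) (β (c + 1)) (v c)) {K : ℕ → Finset ℕ+}
    (hK : ∀ c, K c ∈ Schreier n) (hKs : ∀ c, ∀ i ∈ K c, β c ≤ i ∧ i < β (c + 1))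
    (hN : N ≤ β 0) :
    ∃ F ∈ Schreier (n + 1), (∀ i ∈ F, β 0 ≤ i ∧ i < β N) ∧
      ∑ c ∈ Finset.range N, fam w (K c) (v c) ≤ fam w F (∑ c ∈ Finset.range N, v c) := by
  set G := (Finset.range N).image β with hG
  have hinv : ∀ c, Function.invFun β (β c) = c := Function.leftInverse_invFun hβ.injective
  have hseg : ∀ c i, β c ≤ i → i < β (c + 1) → Seg G (β c) i := by
    intro c i h1 h2
    refine ⟨h1, fun g hg hlt => ?_⟩
    obtain ⟨d, -, rfl⟩ := Finset.mem_image.1 hg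
    exact h2.trans_le (hβ.monotone (Nat.succ_le_of_lt (hβ.lt_iff_lt.1 hlt)))
  have hsegK : ∀ g ∈ G, ∀ a ∈ K (Function.invFun β g), Seg G g a := by
    intro g hg a ha
    obtain ⟨c, -, rfl⟩ := Finset.mem_image.1 hg
    rw [hinv] at ha
    exact hseg c a (hKs c a ha).1 (hKs c a ha).2
  refine ⟨G.biUnion fun g => K (Function.invFun β g), biUnion_mem_schreier_succ ?_
    (fun _ _ => hK _) hsegK, ?_, le_trans ?_ (sum_fam_le_fam_biUnion w hsegK _)⟩
  · intro a ha
    obtain ⟨c, -, rfl⟩ := Finset.mem_image.1 ha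
    calc G.card ≤ (Finset.range N).card := Finset.card_image_le
      _ = N := Finset.card_range N
      _ ≤ β 0 := hN
      _ ≤ β c := hβ.monotone (Nat.zero_le c)
  · intro i hi
    obtain ⟨g, hg, hi⟩ := Finset.mem_biUnion.1 hi
    obtain ⟨c, hc, rfl⟩ := Finset.mem_image.1 hg
    rw [hinv] at hi
    exact ⟨(hβ.monotone (Nat.zero_le c)).trans (hKs c i hi).1,
      (hKs c i hi).2.trans_le (hβ.monotone (Nat.succ_le_of_lt (Finset.mem_range.1 hc)))⟩
  · rw [hG, Finset.sum_image fun i _ j _ h => hβ.injective h]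
    refine Finset.sum_le_sum fun c hc => Finset.sum_le_sum_of_subset_of_nonneg (by rw [hinv])
      (fun _ _ _ => tsNorm_nonneg w _) |>.trans' ?_
    refine Finset.sum_le_sum fun f _ => tsNorm_le_of_abs_le w fun i => ?_
    by_cases h0 : v c i = 0
    · simp [Finsupp.filter_apply, h0]
    · have h1 := hv c i h0
      simp only [Finsupp.filter_apply, hinv]
      rw [if_pos (hseg c i h1.1 h1.2),
        sum_apply_of_suppIn hβ.monotone (fun c _ => hv c) hc h1.1 h1.2]

end Average

/-! ### Iterated averages -/

theorem l1_add_le (x y : ℕ+ →₀ ℝ) : l1 (x + y) ≤ l1 x + l1 y := by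
  classical
  rw [l1_eq_sum (x := x + y) Finsupp.support_add,
    l1_eq_sum (x := x) (s := x.support ∪ y.support) Finset.subset_union_left,
    l1_eq_sum (x := y) (s := x.support ∪ y.support) Finset.subset_union_right,
    ← Finset.sum_add_distrib]
  exact Finset.sum_le_sum fun i _ => abs_add_le _ _

theorem l1_smul (c : ℝ) (x : ℕ+ →₀ ℝ) : l1 (c • x) = |c| * l1 x := by
  rw [l1_eq_sum (x := c • x) Finsupp.support_smul, l1, Finset.mul_sum]
  exact Finset.sum_congr rfl fun i _ => by simp [abs_mul]

theorem l1_sum_le {ι : Type*} (s : Finset ι) (x : ι → ℕ+ →₀ ℝ) :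
    l1 (∑ c ∈ s, x c) ≤ ∑ c ∈ s, l1 (x c) :=
  Finset.le_sum_of_subadditive _ (by simp [l1]) l1_add_le _ _

theorem IsBlock.suppIn_linearCombination {w : Weights} {σ : ℕ → ℕ+} {X : ℕ → ℕ+ →₀ ℝ}
    (hX : IsBlock w σ X) {k l : ℕ} {a : ℕ →₀ ℝ} (ha : a.support ⊆ Finset.Ico k l) :
    SuppIn (σ k) (σ l) (Finsupp.linearCombination ℝ X a) := by
  refine hX.suppIn_of_mem_span
    ((Finsupp.mem_span_image_iff_linearCombination ℝ).2 ⟨a, ?_, rfl⟩)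
  intro i hi
  simpa using ha hi

section Tree

variable (w : Weights) {θ : ℝ}

/-- One coefficient vector serves both sequences. On `Z` every layer adds the same amount after
scaling by `θ ^ h`. On `U` the table `g n h` bounds families of order `n` at height `h`: `hg3` peels
off one layer and one order, and `hg2` unfolds the norm when the order is 0. The number `p` of
covering sets is arbitrary because the next step needs `p * P j + 1` of them. -/
theorem exists_iterated_average (hθ₀ : 0 < θ) (hθ₁ : θ ≤ 1) {σ P : ℕ → ℕ+}
    {Z U : ℕ → ℕ+ →₀ ℝ} (hZ : IsBlock w σ Z) (hU : IsBlock w P U) (hU1 : ∀ k, l1 (U k) ≤ 1)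
    {c₀ : ℝ} (hc₀ : 0 ≤ c₀)
    (hlow : ∀ k, ∀ m ≤ k, ∃ F ∈ Schreier m, F ⊆ (Z k).support ∧
      c₀ * θ⁻¹ ^ m ≤ fam w F (Z k))
    {g : ℕ → ℕ → ℝ} (hg1 : ∀ n, 1 ≤ g n 0) (hg0 : ∀ h, 1 ≤ g 0 h)
    (hg2 : ∀ n h, 1 + θ⁻¹ * (w n.succPNat * g n h) ≤ g 0 (h + 1))
    (hg3 : ∀ n h, 1 + θ⁻¹ * g n h ≤ g (n + 1) (h + 1)) (h : ℕ) :
    ∃ D : ℝ, 0 ≤ D ∧ ∀ ε : ℝ, 0 < ε → ∀ p : ℕ, 1 ≤ p → ∀ k₀ : ℕ, ∃ k₁ > k₀, ∃ a : ℕ →₀ ℝ,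
      a.support ⊆ Finset.Ico k₀ k₁ ∧ l1 (Finsupp.linearCombination ℝ U a) ≤ D ∧
      (∃ F ∈ Schreier h, (∀ i ∈ F, σ k₀ ≤ i ∧ i < σ k₁) ∧
        c₀ * θ * θ⁻¹ ^ h * (h + 1) ≤ fam w F (Finsupp.linearCombination ℝ Z a)) ∧
      ∀ n F, CoveredBy p n F → fam w F (Finsupp.linearCombination ℝ U a) ≤ g n h + ε := by
  have hlow' : ∀ k, ∀ m ≤ k, ∃ F ∈ Schreier m, (∀ i ∈ F, σ k ≤ i ∧ i < σ (k + 1)) ∧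
      c₀ * θ⁻¹ ^ m ≤ fam w F (Z k) := by
    intro k m hm
    obtain ⟨F, hF, hFs, hFc⟩ := hlow k m hm
    exact ⟨F, hF, fun i hi => hZ.supp k i (Finsupp.mem_support_iff.1 (hFs hi)), hFc⟩
  induction h with
  | zero =>
    refine ⟨1, zero_le_one, fun ε hε p _ k₀ => ⟨k₀ + 1, Nat.lt_succ_self _, Finsupp.single k₀ 1,
      ?_, ?_, ?_, ?_⟩⟩
    · intro i hi
      have := Finsupp.support_single_subset hi
      rw [Finset.mem_singleton] at this
      simp [this]
    · simpa using hU1 k₀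
    · obtain ⟨F, hF, hFs, hFc⟩ := hlow' k₀ 0 (Nat.zero_le _)
      refine ⟨F, hF, hFs, ?_⟩
      simp only [Finsupp.linearCombination_single, one_smul]
      refine le_trans ?_ hFc
      simp only [pow_zero, mul_one, Nat.cast_zero, zero_add]
      exact mul_le_of_le_one_right hc₀ hθ₁
    · intro n F _
      simp only [Finsupp.linearCombination_single, one_smul]
      have := (fam_le_l1 w F _).trans (hU1 k₀)
      linarith [hg1 n]
  | succ h ih =>
    obtain ⟨D, hD, ih⟩ := ih
    refine ⟨1 + θ⁻¹ * D, by positivity, fun ε hε p hp k₀ => ?_⟩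
    -- Large `N` makes the exceptional blocks, which carry total ℓ₁-mass at most `2 * p * D` before
    -- scaling by `(θ * N)⁻¹`, cost at most `ε / 2`.
    obtain ⟨N, hN⟩ := exists_nat_gt (4 * p * D / (θ * ε))
    have hNpos : 0 < (N : ℝ) := lt_of_le_of_lt (by positivity) hN
    have hN0 : 0 < N := by exact_mod_cast hNpos
    have hNε : 4 * p * D < N * (θ * ε) := by rwa [div_lt_iff₀ (by positivity)] at hN
    -- `k ≥ h` gives an `S_h`-family on `Z k`, and `k ≥ N + 1` makes the `N + 1` pieces
    -- `S_1`-admissible.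
    set k := max k₀ (max h (N + 1)) with hk
    have hkh : h ≤ k := (le_max_left _ _).trans (le_max_right _ _)
    have hkN : N + 1 ≤ k := (le_max_right _ _).trans (le_max_right _ _)
    choose r hr A hA hAD hAlow hAup using fun j : ℕ =>
      ih (θ * ε / 2) (by positivity) (p * P j + 1) (by omega) j
    let κ : ℕ → ℕ := fun c => r^[c] (k + 1)
    have hκs : ∀ c, κ (c + 1) = r (κ c) := fun c => Function.iterate_succ_apply' r c _
    have hκ : StrictMono κ := strictMono_nat_of_lt_succ fun c => by
      rw [hκs]
      exact hr _
    have hkκ : k < κ N := (Nat.lt_succ_self k).trans_le (hκ.monotone (Nat.zero_le N))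
    set t : ℝ := (θ * N)⁻¹ with ht
    have htpos : 0 < t := by positivity
    have htN : t * N = θ⁻¹ := by
      rw [ht]
      field_simp
    set a : ℕ →₀ ℝ := Finsupp.single k 1 + t • ∑ c ∈ Finset.range N, A (κ c) with ha
    have hlc : ∀ X : ℕ → ℕ+ →₀ ℝ, Finsupp.linearCombination ℝ X a =
        X k + t • ∑ c ∈ Finset.range N, Finsupp.linearCombination ℝ X (A (κ c)) := by
      intro X
      rw [ha, map_add, map_smul, map_sum, Finsupp.linearCombination_single, one_smul]
    have hα : StrictMono fun c => P (κ c) := hU.mono.comp hκ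
    have hy : ∀ c, SuppIn (P (κ c)) (P (κ (c + 1))) (Finsupp.linearCombination ℝ U (A (κ c))) :=
      fun c => hU.suppIn_linearCombination (by rw [hκs]; exact hA _)
    refine ⟨κ N, lt_of_le_of_lt (le_max_left _ _) hkκ, a, ?_, ?_, ?_, ?_⟩
    · intro i hi
      rw [Finset.mem_Ico]
      by_contra hcon
      refine Finsupp.mem_support_iff.1 hi ?_
      have h1 : i ≠ k := by
        rintro rfl
        exact hcon ⟨le_max_left _ _, hkκ⟩
      have h2 : ∀ c ∈ Finset.range N, A (κ c) i = 0 := by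
        intro c hc
        by_contra hne
        have h3 := Finset.mem_Ico.1 (hA (κ c) (Finsupp.mem_support_iff.2 hne))
        rw [← hκs] at h3
        refine hcon ⟨?_, h3.2.trans_le (hκ.monotone (Nat.succ_le_of_lt (Finset.mem_range.1 hc)))⟩
        have h4 : κ 0 ≤ κ c := hκ.monotone (Nat.zero_le c)
        exact (le_max_left _ _).trans ((Nat.le_succ k).trans (h4.trans h3.1))
      rw [ha, Finsupp.add_apply, Finsupp.smul_apply, Finsupp.finsetSum_apply,
        Finset.sum_eq_zero h2, Finsupp.single_apply, if_neg h1.symm]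
      simp
    · rw [hlc]
      refine (l1_add_le _ _).trans (add_le_add (hU1 k) ?_)
      rw [l1_smul, abs_of_pos htpos]
      calc _ ≤ t * ∑ c ∈ Finset.range N, D :=
            mul_le_mul_of_nonneg_left ((l1_sum_le _ _).trans
              (Finset.sum_le_sum fun c _ => hAD (κ c))) htpos.le
        _ = t * N * D := by
            rw [Finset.sum_const, Finset.card_range, nsmul_eq_mul, mul_assoc]
        _ = _ := by rw [htN]
    · obtain ⟨F₀, hF₀, hF₀s, hF₀c⟩ := hlow' k h hkh
      choose B hB hBs hBc using hAlow
      -- The new vector at index `k` is prepended to the `N` averaged vectors, so that all `N + 1`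
      -- pieces are glued at once.
      let ρ : ℕ → ℕ := fun c => Nat.casesOn c k κ
      have hρ : StrictMono ρ := strictMono_nat_of_lt_succ fun c => by
        cases c with
        | zero => exact Nat.lt_succ_self k
        | succ c => exact hκ (Nat.lt_succ_self c)
      let v : ℕ → ℕ+ →₀ ℝ := fun c =>
        Nat.casesOn c (Z k) fun c => t • Finsupp.linearCombination ℝ Z (A (κ c))
      let K : ℕ → Finset ℕ+ := fun c => Nat.casesOn c F₀ fun c => B (κ c)
      obtain ⟨F, hF, hFs, hFc⟩ := exists_fam_sum_ge w (n := h) (N := N + 1)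
        (β := fun c => σ (ρ c)) (hZ.mono.comp hρ) (v := v) (K := K)
        (fun c => by
          cases c with
          | zero => exact hZ.supp k
          | succ c =>
            refine SuppIn.smul ?_ t
            have := hZ.suppIn_linearCombination (hA (κ c))
            rwa [← hκs] at this)
        (fun c => by
          cases c with
          | zero => exact hF₀
          | succ c => exact hB _)
        (fun c => by
          cases c with
          | zero => exact hF₀s
          | succ c =>
            have := hBs (κ c)
            rwa [← hκs] at this)
        (hkN.trans (le_of_strictMono_pnat hZ.mono k))
      have hv : Finsupp.linearCombination ℝ Z a = ∑ c ∈ Finset.range (N + 1), v c := by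
        rw [hlc, Finset.sum_range_succ', add_comm, Finset.smul_sum]
        rfl
      refine ⟨F, hF, fun i hi => ⟨?_, (hFs i hi).2⟩, ?_⟩
      · exact (hZ.mono.monotone (le_max_left _ _)).trans (hFs i hi).1
      rw [hv]
      refine le_trans ?_ hFc
      rw [Finset.sum_range_succ']
      have h1 : ∀ c ∈ Finset.range N,
          t * (c₀ * θ * θ⁻¹ ^ h * (h + 1)) ≤ fam w (K (c + 1)) (v (c + 1)) := by
        intro c _
        show _ ≤ fam w (B (κ c)) (t • Finsupp.linearCombination ℝ Z (A (κ c)))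
        rw [fam_smul, abs_of_pos htpos]
        exact mul_le_mul_of_nonneg_left (hBc _) htpos.le
      have h2 := Finset.sum_le_sum h1
      rw [Finset.sum_const, Finset.card_range, nsmul_eq_mul] at h2
      have h3 : (N : ℝ) * (t * (c₀ * θ * θ⁻¹ ^ h * (h + 1))) =
          c₀ * θ * θ⁻¹ ^ (h + 1) * (h + 1) := by
        rw [← mul_assoc, mul_comm (N : ℝ), htN, pow_succ]
        ring
      have h4 : c₀ * θ⁻¹ ^ h = c₀ * θ * θ⁻¹ ^ (h + 1) := by
        rw [pow_succ]
        field_simp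
      have h5 : c₀ * θ⁻¹ ^ h ≤ fam w (K 0) (v 0) := hF₀c
      push_cast
      linarith
    · intro n F hF
      rw [hlc]
      refine (fam_add_le w F _ _).trans ?_
      rw [fam_smul, abs_of_pos htpos]
      have h1 : fam w F (U k) ≤ 1 := (fam_le_l1 w F _).trans (hU1 k)
      have htε : t * (2 * p * D) ≤ ε / 2 := by
        rw [ht, inv_mul_le_iff₀ (by positivity)]
        linarith
      have hθinv : θ⁻¹ * (θ * ε / 2) = ε / 2 := by field_simp
      cases n with
      | zero =>
        have h2 := fam_sum_le_of_card_le w hα hy hD (fun c => hAD (κ c)) hp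
          (B := fun n => g n h + θ * ε / 2) (γ := θ * (g 0 (h + 1) - 1) + θ * ε / 2)
          (by have := hg0 (h + 1); have : 0 ≤ g 0 (h + 1) - 1 := by linarith
              positivity)
          (fun c n F hF => hAup (κ c) n F hF)
          (fun n => by
            have h3 := hg2 n h
            have h4 : w n.succPNat * g n h ≤ θ * (g 0 (h + 1) - 1) := by
              have : θ⁻¹ * (w n.succPNat * g n h) ≤ g 0 (h + 1) - 1 := by linarith
              rwa [inv_mul_le_iff₀ hθ₀] at this
            have h5 : w n.succPNat * (θ * ε / 2) ≤ θ * ε / 2 :=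
              mul_le_of_le_one_left (by positivity) (w.lt_one' _).le
            rw [mul_add]
            linarith) hF.card_le N
        have h3 := mul_le_mul_of_nonneg_left h2 htpos.le
        have h4 : t * (N * (θ * (g 0 (h + 1) - 1) + θ * ε / 2) + 2 * p * D) =
            θ⁻¹ * θ * (g 0 (h + 1) - 1) + θ⁻¹ * (θ * ε / 2) + t * (2 * p * D) := by
          rw [← htN]
          ring
        rw [inv_mul_cancel₀ hθ₀.ne', hθinv] at h4
        linarith
      | succ n =>
        have h2 := fam_sum_le_of_coveredBy w hα hy hD (fun c => hAD (κ c))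
          (fun c F hF => hAup (κ c) n F hF) le_rfl hF (Finset.range N)
        have h3 := mul_le_mul_of_nonneg_left h2 htpos.le
        have h4 : t * ((Finset.range N).card * (g n h + θ * ε / 2) + p * D) =
            θ⁻¹ * g n h + θ⁻¹ * (θ * ε / 2) + t * (p * D) := by
          rw [← htN, Finset.card_range]
          ring
        have h5 : 0 ≤ t * (p * D) := by positivity
        rw [hθinv] at h4
        linarith [hg3 n h]

end Tree

/-! ### Block bases of the mixed Tsirelson space -/

section Space

variable (w : Weights)

/-- The embedding of `c₀₀` into the mixed Tsirelson space. -/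
def toSpace : (ℕ+ →₀ ℝ) →ₗ[ℝ] Space w :=
  (UniformSpace.Completion.toComplL (𝕜 := ℝ) (E := C00 w)).toLinearMap

theorem norm_toSpace (x : ℕ+ →₀ ℝ) : ‖toSpace w x‖ = tsNorm w x :=
  UniformSpace.Completion.norm_coe (E := C00 w) x

theorem unitBasis_apply (k : ℕ) :
    unitBasis w k = toSpace w (Finsupp.single k.succPNat 1) := rfl

theorem isBlock_single {n : ℕ → ℕ} (hn : StrictMono n) :
    IsBlock w (fun k => (n k).succPNat) fun k => Finsupp.single (n k).succPNat 1 where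
  mono := fun _ _ h => Nat.succPNat_strictMono (hn h)
  supp k i hi := by
    rw [Finsupp.single_apply] at hi
    have : (n k).succPNat = i := by
      by_contra h
      exact hi (if_neg h)
    subst this
    exact ⟨le_rfl, Nat.succPNat_strictMono (hn (Nat.lt_succ_self k))⟩
  norm k := tsNorm_single w _

variable {w}

theorem IsBlock.sum_Ico {σ : ℕ → ℕ+} {X : ℕ → ℕ+ →₀ ℝ} (hX : IsBlock w σ X) {p : ℕ → ℕ}
    (hp : StrictMono p) {a : ℕ → ℝ}
    (hn : ∀ k, tsNorm w (∑ i ∈ Finset.Ico (p k) (p (k + 1)), a i • X i) = 1) :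
    IsBlock w (fun k => σ (p k)) fun k => ∑ i ∈ Finset.Ico (p k) (p (k + 1)), a i • X i where
  mono := hX.mono.comp hp
  supp k := SuppIn.sum fun c hc => by
    rw [Finset.mem_Ico] at hc
    exact ((hX.supp c).smul _).mono (hX.mono.monotone hc.1)
      (hX.mono.monotone (Nat.succ_le_of_lt hc.2))
  norm := hn

theorem _root_.IsNormalizedBlockBasis.exists_toSpace {σ : ℕ → ℕ+} {X : ℕ → ℕ+ →₀ ℝ}
    (hX : IsBlock w σ X) {y : ℕ → Space w}
    (hy : IsNormalizedBlockBasis y fun k => toSpace w (X k)) :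
    ∃ (p : ℕ → ℕ) (a : ℕ → ℝ), StrictMono p ∧
      (∀ k, y k = toSpace w (∑ i ∈ Finset.Ico (p k) (p (k + 1)), a i • X i)) ∧
      IsBlock w (fun k => σ (p k)) fun k => ∑ i ∈ Finset.Ico (p k) (p (k + 1)), a i • X i := by
  obtain ⟨p, a, hp, hya, hn⟩ := hy
  have h : ∀ k, y k = toSpace w (∑ i ∈ Finset.Ico (p k) (p (k + 1)), a i • X i) := by
    intro k
    rw [hya, map_sum]
    simp only [map_smul]
  refine ⟨p, a, hp, h, hX.sum_Ico hp fun k => ?_⟩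
  rw [← norm_toSpace, ← h, hn]

/-- Flat vectors are picked one after another, each starting where the preceding coefficient
interval ends. -/
theorem IsBlock.exists_flat_block {θ : ℝ} (hθ₀ : 0 < θ) (hθ₁ : θ ≤ 1)
    (hlo : ∀ n : ℕ+, θ ^ ((n : ℕ) + 1) ≤ w n) {σ : ℕ → ℕ+} {X : ℕ → ℕ+ →₀ ℝ}
    (hX : IsBlock w σ X) :
    ∃ (τ : ℕ → ℕ+) (Y : ℕ → ℕ+ →₀ ℝ), IsBlock w τ Y ∧
      IsNormalizedBlockBasis (fun k => toSpace w (Y k)) (fun k => toSpace w (X k)) ∧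
      ∀ k, ∀ F ∈ Schreier k, ∑ i ∈ F, |Y k i| ≤ (1 / 2) ^ (k + 2) := by
  choose r hr Y hY hYn hYF using fun k : ℕ =>
    hX.hasFlatBlocks w hθ₀ hθ₁ hlo k ((1 / 2) ^ (k + 2)) (by positivity) k
  have hY' := fun k => (Finsupp.mem_span_image_iff_linearCombination ℝ).1 (hY k)
  choose l hl hlY using hY'
  let κ : ℕ → ℕ := fun c => r^[c] 0
  have hκs : ∀ c, κ (c + 1) = r (κ c) := fun c => Function.iterate_succ_apply' r c _
  have hκ : StrictMono κ := strictMono_nat_of_lt_succ fun c => by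
    rw [hκs]
    exact hr _
  have hκid : ∀ c, c ≤ κ c := fun _ => hκ.le_apply
  have hsupp : ∀ d i, l (κ d) i ≠ 0 → κ d ≤ i ∧ i < κ (d + 1) := by
    intro d i hi
    have := hl (κ d) (Finsupp.mem_support_iff.2 hi)
    rwa [← hκs] at this
  -- At each `i` at most one summand is nonzero, and it has `c ≤ κ c ≤ i`, so the finite range
  -- suffices.
  set b : ℕ → ℝ := fun i => ∑ c ∈ Finset.range (i + 1), l (κ c) i with hb
  have hbl : ∀ c i, κ c ≤ i → i < κ (c + 1) → b i = l (κ c) i := by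
    intro c i h1 h2
    refine Finset.sum_eq_single_of_mem c
      (Finset.mem_range.2 (Nat.lt_succ_of_le ((hκid c).trans h1))) fun d _ hne => ?_
    by_contra h0
    have h3 := hsupp d i h0
    rcases lt_or_gt_of_ne hne with h | h
    · exact absurd (h3.2.trans_le (hκ.monotone (Nat.succ_le_of_lt h))) (not_lt.2 h1)
    · exact absurd (h2.trans_le (hκ.monotone (Nat.succ_le_of_lt h))) (not_lt.2 h3.1)
  have hYb : ∀ c, Y (κ c) = ∑ i ∈ Finset.Ico (κ c) (κ (c + 1)), b i • X i := by
    intro c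
    rw [← hlY, Finsupp.linearCombination_apply, Finsupp.sum_of_support_subset _
      (s := Finset.Ico (κ c) (κ (c + 1)))]
    · refine Finset.sum_congr rfl fun i hi => ?_
      rw [Finset.mem_Ico] at hi
      rw [hbl c i hi.1 hi.2]
    · intro i hi
      exact Finset.mem_Ico.2 (hsupp c i (Finsupp.mem_support_iff.1 hi))
    · simp
  refine ⟨fun k => σ (κ k), fun k => Y (κ k), ?_, ⟨κ, b, hκ, fun k => ?_, fun k => ?_⟩, ?_⟩
  · simp only [hYb]
    exact hX.sum_Ico hκ fun k => by rw [← hYb, hYn]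
  · simp only [hYb, map_sum, map_smul]
  · rw [norm_toSpace, hYn]
  · intro k F hF
    refine (hYF (κ k) F (schreier_mono (hκid k) hF)).trans ?_
    exact pow_le_pow_of_le_one (by norm_num) (by norm_num) (Nat.add_le_add_right (hκid k) 2)

/-- The coefficients are at most 1 by unconditionality, so sums over `S_m`-sets are at most `∑ 2 ^
(-(j + 2)) ≤ 1 / 2`. The remaining half of the norm must come from the family term of
`tsNorm_le_of_fam_le_of_sum_le`. -/
theorem exists_fam_ge_of_flat {θ : ℝ} (hθ₀ : 0 < θ) (hθ₁ : θ ≤ 1)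
    (hup : ∀ n : ℕ+, w n ≤ θ ^ (n : ℕ)) (hlo : ∀ n : ℕ+, θ ^ ((n : ℕ) + 1) ≤ w n)
    {τ : ℕ → ℕ+} {Y : ℕ → ℕ+ →₀ ℝ} (hY : IsBlock w τ Y)
    (hflat : ∀ k, ∀ F ∈ Schreier k, ∑ i ∈ F, |Y k i| ≤ (1 / 2) ^ (k + 2))
    {k l : ℕ} {a : ℕ → ℝ} (hn : tsNorm w (∑ i ∈ Finset.Ico k l, a i • Y i) = 1)
    {m : ℕ} (hm : m ≤ k) :
    ∃ F ∈ Schreier m, F ⊆ (∑ i ∈ Finset.Ico k l, a i • Y i).support ∧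
      θ / 2 * θ⁻¹ ^ m ≤ fam w F (∑ i ∈ Finset.Ico k l, a i • Y i) := by
  set Z := ∑ i ∈ Finset.Ico k l, a i • Y i with hZ
  have ha : ∀ j ∈ Finset.Ico k l, |a j| ≤ 1 := by
    intro j hj
    calc |a j| = tsNorm w (a j • Y j) := by rw [tsNorm_smul, hY.norm, mul_one]
      _ ≤ tsNorm w Z := by
          refine tsNorm_le_of_abs_le w fun i => ?_
          by_cases h0 : Y j i = 0
          · simp [h0]
          · have h1 := hY.supp j i h0
            rw [hZ, sum_apply_of_suppIn hY.mono.monotone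
              (fun c _ => (hY.supp c).smul (a c)) hj h1.1 h1.2]
      _ = 1 := hn
  obtain ⟨F, hF, hFs, hFm⟩ := exists_max_fam w m Z
  refine ⟨F, hF, hFs, ?_⟩
  have h1 := tsNorm_le_of_fam_le_of_sum_le w hθ₀ hθ₁ hup hlo m Z _ (1 / 2) hFm fun F' hF' => by
    calc ∑ i ∈ F', |Z i| ≤ ∑ i ∈ F', ∑ j ∈ Finset.Ico k l, |Y j i| := by
          refine Finset.sum_le_sum fun i _ => ?_
          rw [hZ, Finsupp.finsetSum_apply]
          refine (Finset.abs_sum_le_sum_abs _ _).trans (Finset.sum_le_sum fun j hj => ?_)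
          rw [Finsupp.smul_apply, smul_eq_mul, abs_mul]
          exact mul_le_of_le_one_left (abs_nonneg _) (ha j hj)
      _ = ∑ j ∈ Finset.Ico k l, ∑ i ∈ F', |Y j i| := Finset.sum_comm
      _ ≤ ∑ j ∈ Finset.Ico k l, (1 / 2 : ℝ) ^ (j + 2) := by
          refine Finset.sum_le_sum fun j hj => hflat j F' (schreier_mono ?_ hF')
          exact hm.trans (Finset.mem_Ico.1 hj).1
      _ ≤ ∑ j ∈ Finset.range l, (1 / 2 : ℝ) ^ (j + 2) :=
          Finset.sum_le_sum_of_subset_of_nonneg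
            (fun j hj => Finset.mem_range.2 (Finset.mem_Ico.1 hj).2) fun _ _ _ => by positivity
      _ = (∑ j ∈ Finset.range l, (1 / 2 : ℝ) ^ j) * (1 / 4) := by
          rw [Finset.sum_mul]
          refine Finset.sum_congr rfl fun j _ => ?_
          rw [pow_add]
          norm_num
      _ ≤ 2 * (1 / 4) := by
          gcongr
          exact sum_geometric_two_le l
      _ = 1 / 2 := by norm_num
  rw [hn] at h1
  have h2 : 1 / 2 ≤ θ⁻¹ * (θ ^ m * fam w F Z) := by linarith
  calc θ / 2 * θ⁻¹ ^ m = θ⁻¹ ^ m * θ * (1 / 2) := by ring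
    _ ≤ θ⁻¹ ^ m * θ * (θ⁻¹ * (θ ^ m * fam w F Z)) := by gcongr
    _ = fam w F Z := by
        rw [inv_pow]
        field_simp

end Space

/-! ### The growth of the norms of iterated averages of unit vectors -/

/-- An explicit supersolution of the recursion of `exists_iterated_average`. Along diagonals it
solves `1 + θ⁻¹ * g n h = g (n + 1) (h + 1)` exactly. The first row needs `B * (n + 1) + (1 - φ (n +
1)) * X ≥ 1 + D` for `n ≤ h`: orders `n + 1 ≥ L` use the first term, lower orders the second. -/
theorem exists_growth_bound (w : Weights) {θ : ℝ} (hθ₀ : 0 < θ) (hθ₁ : θ < 1) {φ : ℕ → ℝ}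
    (hφ : Monotone φ) (hφ₀ : ∀ n, 0 ≤ φ n) (hφ₁ : ∀ n, φ n < 1)
    (hw : ∀ n : ℕ+, w n = φ n * θ ^ (n : ℕ)) {η : ℝ} (hη : 0 < η) :
    ∃ (C : ℝ) (g : ℕ → ℕ → ℝ), 0 ≤ C ∧ (∀ h, g 0 h ≤ C + η * h) ∧ (∀ n, 1 ≤ g n 0) ∧
      (∀ h, 1 ≤ g 0 h) ∧ (∀ n h, 1 + θ⁻¹ * (w n.succPNat * g n h) ≤ g 0 (h + 1)) ∧
      ∀ n h, 1 + θ⁻¹ * g n h ≤ g (n + 1) (h + 1) := by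
  have h1θ : 0 < 1 - θ := sub_pos.2 hθ₁
  -- `-D` is the fixed point of `x ↦ 1 + θ⁻¹ * x`.
  set D : ℝ := θ / (1 - θ) with hD
  have hD0 : 0 ≤ D := by positivity
  have hDθ : θ⁻¹ * D = 1 + D := by
    rw [hD]
    field_simp
    ring
  obtain ⟨L, hL⟩ := exists_nat_gt ((1 + D) / η)
  have hLpos : 0 < (L : ℝ) := lt_of_le_of_lt (by positivity) hL
  set B : ℝ := (1 + D) / L with hB
  have hB0 : 0 ≤ B := by positivity
  have hBη : B ≤ η := by
    rw [hB, div_le_iff₀ hLpos]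
    rw [div_lt_iff₀ hη] at hL
    linarith
  have hBL : B * L = 1 + D := by
    rw [hB]
    field_simp
  have hφL : 0 < 1 - φ L := sub_pos.2 (hφ₁ L)
  -- `2 + 2 * D` covers orders `n > h`; the last term makes the loss factor `1 - φ L` worth `1 + D`.
  set A : ℝ := 2 + 2 * D + (1 + D) / (1 - φ L) with hA
  have hA1 : 2 + 2 * D ≤ A := le_add_of_nonneg_right (by positivity)
  have hA2 : 1 + D ≤ (1 - φ L) * A := by
    have : (1 - φ L) * ((1 + D) / (1 - φ L)) = 1 + D := by field_simp
    rw [hA, mul_add, this]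
    have : 0 ≤ (1 - φ L) * (2 + 2 * D) := by positivity
    linarith
  let g : ℕ → ℕ → ℝ := fun n h =>
    if n ≤ h then θ⁻¹ ^ n * (A + B * ((h : ℝ) - n)) - D else θ⁻¹ ^ h * (1 + D) - D
  have hg0 : ∀ h, g 0 h = A + B * h - D := fun h => by simp [g]
  refine ⟨A, g, by linarith, fun h => ?_, fun n => ?_, fun h => ?_, fun n h => ?_, fun n h => ?_⟩
  · rw [hg0]
    have : B * h ≤ η * h := by gcongr
    linarith
  · rcases Nat.eq_zero_or_pos n with rfl | hn
    · rw [hg0]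
      push_cast
      linarith
    · simp only [g, if_neg (not_le.2 hn), pow_zero]
      linarith
  · rw [hg0]
    have : 0 ≤ B * h := by positivity
    linarith
  · have hw' : w n.succPNat = φ (n + 1) * θ ^ (n + 1) := hw n.succPNat
    have hφn := hφ₀ (n + 1)
    have hφn1 := (hφ₁ (n + 1)).le
    have hcoef : θ⁻¹ * (w n.succPNat * g n h) = φ (n + 1) * (θ ^ n * g n h) := by
      rw [hw', pow_succ]
      field_simp
    rw [hcoef, hg0]
    push_cast
    rcases le_or_gt n h with hnh | hnh
    · have hnh' : (n : ℝ) ≤ h := by exact_mod_cast hnh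
      set X := A + B * ((h : ℝ) - n) with hX
      have hXA : A ≤ X := le_add_of_nonneg_right (mul_nonneg hB0 (sub_nonneg.2 hnh'))
      have h1 : θ ^ n * g n h ≤ X := by
        have : θ ^ n * g n h = X - θ ^ n * D := by
          simp only [g, if_pos hnh]
          rw [← hX, mul_sub, ← mul_assoc, ← mul_pow, mul_inv_cancel₀ hθ₀.ne', one_pow, one_mul]
        rw [this]
        have : 0 ≤ θ ^ n * D := by positivity
        linarith
      have h2 : φ (n + 1) * (θ ^ n * g n h) ≤ φ (n + 1) * X := by gcongr
      have h3 : B * (h + 1) + A = X + B * (n + 1) := by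
        rw [hX]
        ring
      rcases le_or_gt L (n + 1) with hLn | hLn
      · have h4 : φ (n + 1) * X ≤ X := mul_le_of_le_one_left (by linarith) hφn1
        have h5 : B * L ≤ B * (n + 1) := by
          gcongr
          exact_mod_cast hLn
        linarith
      · have h4 : φ (n + 1) * X ≤ φ L * X := by
          have : 0 ≤ X := by linarith
          gcongr
          exact hφ hLn.le
        have h5 : (1 - φ L) * A ≤ (1 - φ L) * X := by gcongr
        have h6 : 0 ≤ B * ((n : ℝ) + 1) := by positivity
        linarith
    · have h1 : θ ^ n * g n h ≤ 1 + D := by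
        simp only [g, if_neg (not_le.2 hnh)]
        have h2 : θ ^ n * θ⁻¹ ^ h ≤ 1 := by
          rw [inv_pow, ← div_eq_mul_inv, div_le_one (by positivity)]
          exact pow_le_pow_of_le_one hθ₀.le hθ₁.le hnh.le
        have h3 : θ ^ n * θ⁻¹ ^ h * (1 + D) ≤ 1 * (1 + D) := by gcongr
        have h4 : 0 ≤ θ ^ n * D := by positivity
        linarith
      have h2 : φ (n + 1) * (θ ^ n * g n h) ≤ 1 + D :=
        (mul_le_mul_of_nonneg_left h1 hφn).trans (mul_le_of_le_one_left (by linarith) hφn1)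
      have : 0 ≤ B * ((h : ℝ) + 1) := by positivity
      linarith
  · by_cases hnh : n ≤ h
    · simp only [g, if_pos hnh, if_pos (Nat.succ_le_succ hnh)]
      push_cast
      have : θ⁻¹ ^ (n + 1) * (A + B * ((h : ℝ) + 1 - (n + 1))) =
          θ⁻¹ * (θ⁻¹ ^ n * (A + B * ((h : ℝ) - n))) := by ring
      rw [this, mul_sub, hDθ]
      linarith
    · simp only [g, if_neg hnh, if_neg (fun h' => hnh (Nat.le_of_succ_le_succ h'))]
      rw [mul_sub, hDθ, pow_succ]
      linarith

/-! ### Strong non-subsequential minimality -/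

/-- Only one half of equivalence is contradicted: the subsequence of unit vectors does not dominate
`z`, since the same averages grow at least like `c * h` on `z` and at most like `C + η * h` on the
unit vectors. -/
theorem stronglyNonSubsequentiallyMinimal (w : Weights) {θ : ℝ} (hθ₀ : 0 < θ) (hθ₁ : θ < 1)
    {φ : ℕ → ℝ} (hφ : Monotone φ) (hφ₀ : ∀ n, θ ≤ φ n) (hφ₁ : ∀ n, φ n < 1)
    (hw : ∀ n : ℕ+, w n = φ n * θ ^ (n : ℕ)) :
    StronglyNonSubsequentiallyMinimal (unitBasis w) := by
  have hup : ∀ n : ℕ+, w n ≤ θ ^ (n : ℕ) := fun n => by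
    rw [hw]
    exact mul_le_of_le_one_left (by positivity) (hφ₁ n).le
  have hlo : ∀ n : ℕ+, θ ^ ((n : ℕ) + 1) ≤ w n := fun n => by
    rw [hw, pow_succ, mul_comm]
    exact mul_le_mul_of_nonneg_right (hφ₀ n) (by positivity)
  refine ⟨norm_unitBasis w, fun x hx => ?_⟩
  obtain ⟨p, a, -, hxX, hX⟩ := IsNormalizedBlockBasis.exists_toSpace
    (isBlock_single w strictMono_id) (y := x) hx
  obtain ⟨τ, Y, hY, hYX, hflat⟩ := hX.exists_flat_block hθ₀ hθ₁.le hlo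
  refine ⟨fun k => toSpace w (Y k), ?_, fun z hz => ?_⟩
  · rwa [funext hxX]
  rintro ⟨n, hn, -, K, hK⟩
  obtain ⟨q, d, hq, hzZ, hZ⟩ := IsNormalizedBlockBasis.exists_toSpace hY hz
  set Z : ℕ → ℕ+ →₀ ℝ := fun k => ∑ i ∈ Finset.Ico (q k) (q (k + 1)), d i • Y i with hZdef
  set U : ℕ → ℕ+ →₀ ℝ := fun k => Finsupp.single (n k).succPNat 1 with hUdef
  have hU : IsBlock w (fun k => (n k).succPNat) U := isBlock_single w hn
  have hlow : ∀ k, ∀ m ≤ k, ∃ F ∈ Schreier m, F ⊆ (Z k).support ∧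
      θ / 2 * θ⁻¹ ^ m ≤ fam w F (Z k) := fun k m hm =>
    exists_fam_ge_of_flat hθ₀ hθ₁.le hup hlo hY hflat (hZ.norm k) (hm.trans (hq.le_apply))
  have hdom : ∀ a : ℕ →₀ ℝ, tsNorm w (Finsupp.linearCombination ℝ Z a) ≤
      max K 1 * tsNorm w (Finsupp.linearCombination ℝ U a) := by
    intro a
    have hs : ∀ X : ℕ → ℕ+ →₀ ℝ, a.sum (fun n c => c • toSpace w (X n)) =
        toSpace w (Finsupp.linearCombination ℝ X a) := by
      intro X
      rw [Finsupp.linearCombination_apply, map_finsuppSum]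
      simp only [map_smul]
    have h1 := hK a
    simp only [hzZ, unitBasis_apply] at h1
    rw [hs, hs U, norm_toSpace, norm_toSpace] at h1
    exact h1.trans (mul_le_mul_of_nonneg_right (le_max_left _ _) (tsNorm_nonneg w _))
  set K' := max K 1
  have hK' : 0 < K' := lt_max_of_lt_right one_pos
  -- `θ / 2` comes from flatness, one `θ` from the averages and one from `θ ^ (h + 1)` in the norm
  -- estimate. With `η = c / (2 * K')`, half of the linear growth survives the domination constant.
  set c : ℝ := θ / 2 * θ ^ 2 with hc
  have hcpos : 0 < c := by positivity
  obtain ⟨C, g, hC, hgC, hg1, hg0, hg2, hg3⟩ := exists_growth_bound w hθ₀ hθ₁ hφ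
    (fun n => hθ₀.le.trans (hφ₀ n)) hφ₁ hw (η := c / (2 * K')) (by positivity)
  obtain ⟨h, hh⟩ := exists_nat_gt (2 * K' * (C + 1) / c)
  obtain ⟨D, -, hD⟩ := exists_iterated_average w hθ₀ hθ₁.le hZ hU (fun k => by simp [hUdef, l1])
    (by positivity) hlow hg1 hg0 hg2 hg3 h
  obtain ⟨k₁, -, b, -, -, ⟨F, hF, -, hFb⟩, hup'⟩ := hD 1 one_pos 1 le_rfl 0
  have h1 : c * (h + 1) ≤ tsNorm w (Finsupp.linearCombination ℝ Z b) := by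
    refine le_trans ?_ (pow_mul_fam_le_tsNorm w hθ₁.le hlo h hF _)
    refine le_trans (le_of_eq ?_) (mul_le_mul_of_nonneg_left hFb (by positivity))
    rw [hc, inv_pow, pow_succ θ h]
    field_simp
  have h2 : tsNorm w (Finsupp.linearCombination ℝ U b) ≤ g 0 h + 1 := by
    -- The segment of 1 in `{1}` is everything, so this family gives the full norm.
    refine le_trans (le_of_eq ?_) (hup' 0 {1} (coveredBy_of_mem (singleton_mem_schreier 0 1)))
    rw [fam, Finset.sum_singleton]
    congr 1
    symm
    rw [Finsupp.filter_eq_self_iff]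
    intro i _
    exact ⟨one_le, by simp⟩
  have h3 : c * (h + 1) ≤ K' * (C + c / (2 * K') * h + 1) :=
    h1.trans ((hdom b).trans (mul_le_mul_of_nonneg_left (h2.trans (by linarith [hgC h])) hK'.le))
  have h4 : K' * (C + c / (2 * K') * h + 1) = K' * (C + 1) + c * h / 2 := by
    field_simp
    ring
  rw [div_lt_iff₀ hcpos] at hh
  linarith

end MixedTsirelson

/-! ### The choice of weights -/

theorem mainTheorem10 (θ : ℝ) (hθ₀ : 0 < θ) (hθ₁ : θ < 1) :
    ∃ w : MixedTsirelson.Weights, w.IsRegular ∧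
      IsLUB (Set.range fun n : ℕ+ => (w n) ^ (1 / ((n : ℕ) : ℝ))) θ ∧
      Tendsto (fun n : ℕ+ => w n / θ ^ (n : ℕ)) atTop (𝓝 1) ∧
      (∃ c : ℝ, 0 < c ∧ ∀ n : ℕ+, c ≤ w n / θ ^ (n : ℕ)) ∧
      IsLUB (Set.range fun n : ℕ+ => w n / θ ^ (n : ℕ)) 1 ∧
      StronglyNonSubsequentiallyMinimal (MixedTsirelson.unitBasis w) := by
  have h1θ : 0 < 1 - θ := sub_pos.2 hθ₁
  -- Increases from `φ 0 = θ` to 1. The bound `θ ≤ φ m` gives `w n ≤ θ ^ (m + 1) ≤ w m` for `m < n`,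
  -- and monotonicity with `φ n < 1` gives `φ m * φ n ≤ φ (m + n)`.
  set φ : ℕ → ℝ := fun n => 1 - (1 - θ) / (n + 1) with hφdef
  have hφ₀ : ∀ n, θ ≤ φ n := fun n => by
    have : (1 - θ) / ((n : ℝ) + 1) ≤ 1 - θ :=
      div_le_self h1θ.le (by linarith [n.cast_nonneg (α := ℝ)])
    simp only [hφdef]
    linarith
  have hφ₁ : ∀ n, φ n < 1 := fun n => by
    have : 0 < (1 - θ) / ((n : ℝ) + 1) := by positivity
    simp only [hφdef]
    linarith
  have hφpos : ∀ n, 0 < φ n := fun n => hθ₀.trans_le (hφ₀ n)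
  have hφ : Monotone φ := fun m n hmn => by
    have : (1 - θ) / ((n : ℝ) + 1) ≤ (1 - θ) / ((m : ℝ) + 1) := by gcongr
    simp only [hφdef]
    linarith
  have hval : Tendsto (fun n : ℕ+ => (n : ℕ)) atTop atTop := tendsto_PNat_val_atTop_atTop
  have hφt : Tendsto φ atTop (𝓝 1) := by
    have h := (tendsto_one_div_add_atTop_nhds_zero_nat (𝕜 := ℝ)).const_mul (1 - θ)
    have h' := h.const_sub 1
    rw [mul_zero, sub_zero] at h'
    refine h'.congr fun n => ?_
    simp only [hφdef]
    rw [mul_one_div]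
  have hφt' : Tendsto (fun n : ℕ+ => φ n) atTop (𝓝 1) := hφt.comp hval
  let w : MixedTsirelson.Weights :=
    { toFun := fun n => φ n * θ ^ (n : ℕ)
      pos' := fun n => mul_pos (hφpos n) (by positivity)
      lt_one' := fun n => mul_lt_one_of_nonneg_of_lt_one_left (hφpos n).le (hφ₁ n)
        (pow_le_one₀ hθ₀.le hθ₁.le)
      tendsto' := by
        have := hφt'.mul ((tendsto_pow_atTop_nhds_zero_of_lt_one hθ₀.le hθ₁).comp hval)
        simpa using this }
  have hw : ∀ n : ℕ+, w n = φ n * θ ^ (n : ℕ) := fun _ => rfl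
  have hquot : ∀ n : ℕ+, w n / θ ^ (n : ℕ) = φ n := fun n => by
    rw [hw, mul_div_cancel_right₀ _ (pow_ne_zero _ hθ₀.ne')]
  refine ⟨w, ⟨?_, ?_⟩, ?_, ?_, ⟨θ, hθ₀, fun n => ?_⟩, ?_,
    MixedTsirelson.stronglyNonSubsequentiallyMinimal w hθ₀ hθ₁ hφ hφ₀ hφ₁ hw⟩
  · intro m n hmn
    rcases hmn.eq_or_lt with rfl | hlt
    · exact le_rfl
    have hlt' : (m : ℕ) + 1 ≤ n := hlt
    calc w n = φ n * θ ^ (n : ℕ) := hw n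
      _ ≤ 1 * θ ^ ((m : ℕ) + 1) :=
          mul_le_mul (hφ₁ n).le (pow_le_pow_of_le_one hθ₀.le hθ₁.le hlt') (by positivity)
            zero_le_one
      _ = θ * θ ^ (m : ℕ) := by ring
      _ ≤ w m := mul_le_mul_of_nonneg_right (hφ₀ m) (by positivity)
  · intro m n
    rw [hw, hw, hw, PNat.add_coe, pow_add]
    calc φ m * θ ^ (m : ℕ) * (φ n * θ ^ (n : ℕ)) =
          φ m * φ n * (θ ^ (m : ℕ) * θ ^ (n : ℕ)) := by ring
      _ ≤ φ (m + n) * (θ ^ (m : ℕ) * θ ^ (n : ℕ)) := by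
          refine mul_le_mul_of_nonneg_right ?_ (by positivity)
          exact (mul_le_of_le_one_right (hφpos m).le (hφ₁ n).le).trans (hφ (Nat.le_add_right _ _))
  · have hroot : ∀ n : ℕ+, (w n) ^ (1 / ((n : ℕ) : ℝ)) = (φ n) ^ (1 / ((n : ℕ) : ℝ)) * θ := by
      intro n
      have hn : ((n : ℕ) : ℝ) ≠ 0 := by exact_mod_cast n.ne_zero
      rw [hw, Real.mul_rpow (hφpos n).le (by positivity), ← Real.rpow_natCast θ,
        ← Real.rpow_mul hθ₀.le, mul_one_div_cancel hn, Real.rpow_one]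
    constructor
    · rintro _ ⟨n, rfl⟩
      simp only [hroot]
      exact mul_le_of_le_one_left hθ₀.le
        (Real.rpow_le_one (hφpos n).le (hφ₁ n).le (by positivity))
    · intro b hb
      -- As `φ n < 1`, taking the `n`-th root only increases it; so `φ n * θ` is a lower estimate
      -- already tending to `θ`.
      have h1 : ∀ n : ℕ+, φ n * θ ≤ b := fun n => by
        refine le_trans ?_ (hb ⟨n, rfl⟩)
        simp only [hroot]
        refine mul_le_mul_of_nonneg_right ?_ hθ₀.le
        have h2 : 1 / ((n : ℕ) : ℝ) ≤ 1 :=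
          div_le_one_of_le₀ (by exact_mod_cast n.pos) (by positivity)
        simpa using Real.rpow_le_rpow_of_exponent_ge (hφpos n) (hφ₁ n).le h2
      have h3 := hφt'.mul_const θ
      rw [one_mul] at h3
      exact le_of_tendsto' h3 h1
  · simpa only [hquot] using hφt'
  · rw [hquot]
    exact hφ₀ n
  · simp only [hquot]
    constructor
    · rintro _ ⟨n, rfl⟩
      exact (hφ₁ n).le
    · intro b hb
      exact le_of_tendsto' hφt' fun n => hb ⟨n, rfl⟩

end
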